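/- Let $1<p<\infty$, $0<\gamma<1$ and $\frac1p+\frac1q=1$. On the space $c_{00}$ of finitely supported real sequences let $\|\cdot\|$ be the norm given by the implicit equation $$\|a\|=\max\Big\{\|a\|_\infty,\ \gamma\sup\frac{\sum_{j=1}^n\|E_ja\|}{n^{1/q}}\Big\},$$ where the supremum is over all $n\ge1$ and all non-empty finite sets $E_1<\dots<E_n$ of natural numbers (that is, $\max E_j<\min E_{j+1}$), and $E_ja$ is the restriction of $a$ to $E_j$; this norm is the limit of the increasing sequence of norms with $\|a\|_0=\|a\|_\infty$ and $\|a\|_{m+1}=\max\{\|a\|_\infty,\gamma\sup n^{-1/q}\sum_{j=1}^n\|E_ja\|_m\}$. Let the Tirilman space $Ti(p,\gamma)$ be the completion of $(c_{00},\|\cdot\|)$. Then its dual space $Ti^*(p,\gamma)$ does not contain an isomorphic copy of $\ell_q$, that is, no linear subspace of $Ti^*(p,\gamma)$, with the norm of $Ti^*(p,\gamma)$, is linearly homeomorphic to the real sequence space $\ell_q$. -/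

import Mathlib

noncomputable section

namespace Tirilman

/-- The sup norm `‖a‖_∞` of a finitely supported real sequence. -/
def supNorm (a : ℕ →₀ ℝ) : ℝ := ⨆ i, |a i|

/-- The restriction `E a` of the sequence `a` to the finite set `E`. -/
def restrict (E : Finset ℕ) (a : ℕ →₀ ℝ) : ℕ →₀ ℝ := a.filter (· ∈ E)

/-- `E_1 < E_2 < ⋯ < E_n`: non-empty finite sets of natural numbers, each lying entirely
to the left of the following ones. -/
def Consecutive {n : ℕ} (E : Fin n → Finset ℕ) : Prop :=
  (∀ j, (E j).Nonempty) ∧ ∀ i j, i < j → ∀ k ∈ E i, ∀ l ∈ E j, k < l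

/-- For a function `N` on `c₀₀`, the set of all the numbers `n ^ (-1/q) * ∑_{j=1}^n N (E_j a)`,
over all `n ≥ 1` and all `E_1 < ⋯ < E_n`, where `q` is the exponent conjugate to `p`. -/
def admissibleValues (p : ℝ) (N : (ℕ →₀ ℝ) → ℝ) (a : ℕ →₀ ℝ) : Set ℝ :=
  {s | ∃ (n : ℕ) (E : Fin n → Finset ℕ), 1 ≤ n ∧ Consecutive E ∧
    s = (∑ j, N (restrict (E j) a)) / (n : ℝ) ^ (1 / p.conjExponent)}

/-- The recursive sequence of norms on `c₀₀`: the sup norm at stage `0`, and then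
`‖a‖_{m+1} = max {‖a‖_∞, γ * sup n ^ (-1/q) * ∑_j ‖E_j a‖_m}`. -/
def approxNorm (p γ : ℝ) : ℕ → (ℕ →₀ ℝ) → ℝ
  | 0, a => supNorm a
  | m + 1, a => max (supNorm a) (γ * sSup (admissibleValues p (approxNorm p γ m) a))

/-- The Tirilman norm on `c₀₀`, the limit of the increasing sequence `approxNorm p γ m`.
It solves the implicit equation of the Tirilman norm, see `tirNorm_eq`. -/
def tirNorm (p γ : ℝ) (a : ℕ →₀ ℝ) : ℝ := ⨆ m, approxNorm p γ m a

/-! ### Elementary facts: the Tirilman norm is a norm -/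

/-- The `ℓ₁` norm, used as an upper bound only. -/
def oneNorm (a : ℕ →₀ ℝ) : ℝ := ∑ i ∈ a.support, |a i|

lemma oneNorm_eq (a : ℕ →₀ ℝ) {s : Finset ℕ} (h : a.support ⊆ s) :
    oneNorm a = ∑ i ∈ s, |a i| := by
  unfold oneNorm
  refine Finset.sum_subset h fun i _ hi => ?_
  simp [Finsupp.notMem_support_iff.1 hi]

lemma oneNorm_nonneg (a : ℕ →₀ ℝ) : 0 ≤ oneNorm a :=
  Finset.sum_nonneg fun _ _ => abs_nonneg _

lemma abs_le_oneNorm (a : ℕ →₀ ℝ) (i : ℕ) : |a i| ≤ oneNorm a := by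
  by_cases hi : i ∈ a.support
  · exact Finset.single_le_sum (f := fun i => |a i|) (fun _ _ => abs_nonneg _) hi
  · simpa [Finsupp.notMem_support_iff.1 hi] using oneNorm_nonneg a

lemma supNorm_bdd (a : ℕ →₀ ℝ) : BddAbove (Set.range fun i => |a i|) :=
  ⟨oneNorm a, by rintro _ ⟨i, rfl⟩; exact abs_le_oneNorm a i⟩

lemma abs_le_supNorm (a : ℕ →₀ ℝ) (i : ℕ) : |a i| ≤ supNorm a :=
  le_ciSup (supNorm_bdd a) i

lemma supNorm_nonneg (a : ℕ →₀ ℝ) : 0 ≤ supNorm a :=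
  (abs_nonneg _).trans (abs_le_supNorm a 0)

lemma supNorm_le_oneNorm (a : ℕ →₀ ℝ) : supNorm a ≤ oneNorm a :=
  ciSup_le (abs_le_oneNorm a)

lemma supNorm_add (a b : ℕ →₀ ℝ) : supNorm (a + b) ≤ supNorm a + supNorm b :=
  ciSup_le fun i => (abs_add_le (a i) (b i)).trans
    (add_le_add (abs_le_supNorm a i) (abs_le_supNorm b i))

lemma supNorm_smul_le (c : ℝ) (a : ℕ →₀ ℝ) : supNorm (c • a) ≤ |c| * supNorm a :=
  ciSup_le fun i => by
    simpa [abs_mul] using mul_le_mul_of_nonneg_left (abs_le_supNorm a i) (abs_nonneg c)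

lemma restrict_add (E : Finset ℕ) (a b : ℕ →₀ ℝ) :
    restrict E (a + b) = restrict E a + restrict E b := Finsupp.filter_add

lemma restrict_smul (E : Finset ℕ) (c : ℝ) (a : ℕ →₀ ℝ) :
    restrict E (c • a) = c • restrict E a := Finsupp.filter_smul

lemma sum_oneNorm_restrict_le {n : ℕ} {E : Fin n → Finset ℕ} (hE : Consecutive E)
    (a : ℕ →₀ ℝ) : ∑ j, oneNorm (restrict (E j) a) ≤ oneNorm a := by
  classical
  have h1 : ∀ j, oneNorm (restrict (E j) a) = ∑ i ∈ a.support, if i ∈ E j then |a i| else 0 := by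
    intro j
    have hs : (restrict (E j) a).support ⊆ a.support := by
      intro i hi
      rw [Finsupp.mem_support_iff] at hi ⊢
      intro h0
      apply hi
      by_cases hh : i ∈ E j <;> simp [restrict, Finsupp.filter_apply, h0]
    rw [oneNorm_eq _ hs]
    refine Finset.sum_congr rfl fun i _ => ?_
    by_cases hh : i ∈ E j <;> simp [restrict, hh]
  simp_rw [h1]
  rw [Finset.sum_comm]
  refine Finset.sum_le_sum fun i _ => ?_
  by_cases hi : ∃ j, i ∈ E j
  · obtain ⟨j, hj⟩ := hi
    rw [Finset.sum_eq_single j]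
    · simp [hj]
    · intro k _ hk
      rw [if_neg]
      intro hk'
      rcases lt_or_gt_of_ne hk with h | h
      · exact lt_irrefl _ (hE.2 _ _ h _ hk' _ hj)
      · exact lt_irrefl _ (hE.2 _ _ h _ hj _ hk')
    · simp
  · push Not at hi
    simp [hi]

variable {p γ : ℝ}

lemma one_le_rpow (hp : 1 < p) {n : ℕ} (hn : 1 ≤ n) :
    (1 : ℝ) ≤ (n : ℝ) ^ (1 / p.conjExponent) := by
  refine Real.one_le_rpow (by exact_mod_cast hn) ?_
  have : 0 < p.conjExponent := (Real.HolderConjugate.conjExponent hp).symm.pos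
  positivity

lemma admissibleValues_nonempty (N : (ℕ →₀ ℝ) → ℝ) (a : ℕ →₀ ℝ) :
    (admissibleValues p N a).Nonempty :=
  ⟨_, 1, fun _ => {0}, le_rfl, ⟨fun _ => Finset.singleton_nonempty 0, fun i j h =>
    absurd (Subsingleton.elim i j) h.ne⟩, rfl⟩

lemma admissibleValues_le (hp : 1 < p) {N : (ℕ →₀ ℝ) → ℝ} (hN : ∀ b, N b ≤ oneNorm b)
    (a : ℕ →₀ ℝ) : ∀ s ∈ admissibleValues p N a, s ≤ oneNorm a := by
  rintro _ ⟨n, E, hn, hE, rfl⟩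
  have h1 := one_le_rpow hp hn
  rw [div_le_iff₀ (by linarith)]
  calc ∑ j, N (restrict (E j) a) ≤ ∑ j, oneNorm (restrict (E j) a) :=
        Finset.sum_le_sum fun _ _ => hN _
    _ ≤ oneNorm a := sum_oneNorm_restrict_le hE a
    _ ≤ oneNorm a * _ := le_mul_of_one_le_right (oneNorm_nonneg a) h1

lemma admissibleValues_bdd (hp : 1 < p) {N : (ℕ →₀ ℝ) → ℝ} (hN : ∀ b, N b ≤ oneNorm b)
    (a : ℕ →₀ ℝ) : BddAbove (admissibleValues p N a) :=
  ⟨oneNorm a, admissibleValues_le hp hN a⟩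

lemma approxNorm_le_oneNorm (hp : 1 < p) (hγ : γ ∈ Set.Ioo (0 : ℝ) 1) (m : ℕ) :
    ∀ a, approxNorm p γ m a ≤ oneNorm a := by
  induction m with
  | zero => exact supNorm_le_oneNorm
  | succ m ih =>
    intro a
    refine max_le (supNorm_le_oneNorm a) ?_
    have h := csSup_le (admissibleValues_nonempty _ a) (admissibleValues_le hp ih a)
    have h0 := oneNorm_nonneg a
    nlinarith [mul_le_mul_of_nonneg_left h hγ.1.le, hγ.2]

lemma supNorm_le_approxNorm (m : ℕ) (a : ℕ →₀ ℝ) : supNorm a ≤ approxNorm p γ m a := by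
  cases m with
  | zero => exact le_rfl
  | succ m => exact le_max_left _ _

lemma sSup_admissibleValues_mono (hp : 1 < p) {N N' : (ℕ →₀ ℝ) → ℝ}
    (h : ∀ b, N b ≤ N' b) (hN' : ∀ b, N' b ≤ oneNorm b) (a : ℕ →₀ ℝ) :
    sSup (admissibleValues p N a) ≤ sSup (admissibleValues p N' a) := by
  refine csSup_le (admissibleValues_nonempty _ a) ?_
  rintro _ ⟨n, E, hn, hE, rfl⟩
  refine le_trans ?_ (le_csSup (admissibleValues_bdd hp hN' a) ⟨n, E, hn, hE, rfl⟩)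
  have := Finset.sum_le_sum fun j (_ : j ∈ Finset.univ) => h (restrict (E j) a)
  gcongr

lemma approxNorm_le_succ (hp : 1 < p) (hγ : γ ∈ Set.Ioo (0 : ℝ) 1) (m : ℕ) :
    ∀ a, approxNorm p γ m a ≤ approxNorm p γ (m + 1) a := by
  induction m with
  | zero => exact fun a => le_max_left _ _
  | succ m ih =>
    intro a
    exact max_le_max le_rfl (mul_le_mul_of_nonneg_left
      (sSup_admissibleValues_mono hp ih (approxNorm_le_oneNorm hp hγ _) a) hγ.1.le)

lemma approxNorm_mono (hp : 1 < p) (hγ : γ ∈ Set.Ioo (0 : ℝ) 1) (a : ℕ →₀ ℝ) :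
    Monotone fun m => approxNorm p γ m a :=
  monotone_nat_of_le_succ fun m => approxNorm_le_succ hp hγ m a

lemma approxNorm_bdd (hp : 1 < p) (hγ : γ ∈ Set.Ioo (0 : ℝ) 1) (a : ℕ →₀ ℝ) :
    BddAbove (Set.range fun m => approxNorm p γ m a) :=
  ⟨oneNorm a, by rintro _ ⟨m, rfl⟩; exact approxNorm_le_oneNorm hp hγ m a⟩

lemma approxNorm_le_tirNorm (hp : 1 < p) (hγ : γ ∈ Set.Ioo (0 : ℝ) 1) (m : ℕ) (a : ℕ →₀ ℝ) :
    approxNorm p γ m a ≤ tirNorm p γ a :=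
  le_ciSup (approxNorm_bdd hp hγ a) m

lemma tendsto_approxNorm (hp : 1 < p) (hγ : γ ∈ Set.Ioo (0 : ℝ) 1) (a : ℕ →₀ ℝ) :
    Filter.Tendsto (fun m => approxNorm p γ m a) Filter.atTop (nhds (tirNorm p γ a)) :=
  tendsto_atTop_ciSup (approxNorm_mono hp hγ a) (approxNorm_bdd hp hγ a)

lemma tirNorm_le_oneNorm (hp : 1 < p) (hγ : γ ∈ Set.Ioo (0 : ℝ) 1) (a : ℕ →₀ ℝ) :
    tirNorm p γ a ≤ oneNorm a :=
  ciSup_le fun m => approxNorm_le_oneNorm hp hγ m a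

/-- The implicit equation of the Tirilman norm:
`‖a‖ = max {‖a‖_∞, γ * sup n ^ (-1/q) * ∑_j ‖E_j a‖}`. -/
theorem tirNorm_eq (hp : 1 < p) (hγ : γ ∈ Set.Ioo (0 : ℝ) 1) (a : ℕ →₀ ℝ) :
    tirNorm p γ a =
      max (supNorm a) (γ * sSup (admissibleValues p (tirNorm p γ) a)) := by
  apply le_antisymm
  · refine ciSup_le fun m => (approxNorm_le_succ hp hγ m a).trans ?_
    exact max_le_max le_rfl (mul_le_mul_of_nonneg_left
      (sSup_admissibleValues_mono hp (approxNorm_le_tirNorm hp hγ m)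
        (tirNorm_le_oneNorm hp hγ) a) hγ.1.le)
  · refine max_le (approxNorm_le_tirNorm hp hγ 0 a) ?_
    rw [← le_div_iff₀' hγ.1]
    refine csSup_le (admissibleValues_nonempty _ a) ?_
    rintro _ ⟨n, E, hn, hE, rfl⟩
    have ht : Filter.Tendsto (fun m => (∑ j, approxNorm p γ m (restrict (E j) a)) /
        (n : ℝ) ^ (1 / p.conjExponent)) Filter.atTop
        (nhds ((∑ j, tirNorm p γ (restrict (E j) a)) / (n : ℝ) ^ (1 / p.conjExponent))) :=
      (tendsto_finsetSum _ fun j _ => tendsto_approxNorm hp hγ _).div_const _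
    refine le_of_tendsto' ht fun m => ?_
    rw [le_div_iff₀' hγ.1]
    refine le_trans ?_ (approxNorm_le_tirNorm hp hγ (m + 1) a)
    refine le_trans ?_ (le_max_right _ _)
    exact mul_le_mul_of_nonneg_left (le_csSup
      (admissibleValues_bdd hp (approxNorm_le_oneNorm hp hγ m) a) ⟨n, E, hn, hE, rfl⟩) hγ.1.le

lemma approxNorm_add (hp : 1 < p) (hγ : γ ∈ Set.Ioo (0 : ℝ) 1) (m : ℕ) :
    ∀ a b, approxNorm p γ m (a + b) ≤ approxNorm p γ m a + approxNorm p γ m b := by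
  induction m with
  | zero => exact supNorm_add
  | succ m ih =>
    intro a b
    refine max_le ((supNorm_add a b).trans
      (add_le_add (le_max_left _ _) (le_max_left _ _))) ?_
    refine le_trans ?_ (add_le_add (le_max_right _ _) (le_max_right _ _))
    rw [← mul_add]
    refine mul_le_mul_of_nonneg_left ?_ hγ.1.le
    refine csSup_le (admissibleValues_nonempty _ _) ?_
    rintro _ ⟨n, E, hn, hE, rfl⟩
    have hb := admissibleValues_bdd hp (approxNorm_le_oneNorm (γ := γ) hp hγ m)
    refine le_trans ?_ (add_le_add (le_csSup (hb a) ⟨n, E, hn, hE, rfl⟩)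
      (le_csSup (hb b) ⟨n, E, hn, hE, rfl⟩))
    rw [← add_div, ← Finset.sum_add_distrib]
    gcongr
    rw [restrict_add]
    exact ih _ _

lemma approxNorm_smul_le (hp : 1 < p) (hγ : γ ∈ Set.Ioo (0 : ℝ) 1) (c : ℝ) (m : ℕ) :
    ∀ a, approxNorm p γ m (c • a) ≤ |c| * approxNorm p γ m a := by
  induction m with
  | zero => exact supNorm_smul_le c
  | succ m ih =>
    intro a
    refine max_le ((supNorm_smul_le c a).trans
      (mul_le_mul_of_nonneg_left (le_max_left _ _) (abs_nonneg c))) ?_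
    refine le_trans ?_ (mul_le_mul_of_nonneg_left (le_max_right _ _) (abs_nonneg c))
    rw [mul_left_comm]
    refine mul_le_mul_of_nonneg_left ?_ hγ.1.le
    refine csSup_le (admissibleValues_nonempty _ _) ?_
    rintro _ ⟨n, E, hn, hE, rfl⟩
    have hb := admissibleValues_bdd hp (approxNorm_le_oneNorm (γ := γ) hp hγ m)
    refine le_trans ?_ (mul_le_mul_of_nonneg_left (le_csSup (hb a) ⟨n, E, hn, hE, rfl⟩)
      (abs_nonneg c))
    rw [← mul_div_assoc, Finset.mul_sum]
    gcongr
    rw [restrict_smul]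
    exact ih _

lemma tirNorm_add (hp : 1 < p) (hγ : γ ∈ Set.Ioo (0 : ℝ) 1) (a b : ℕ →₀ ℝ) :
    tirNorm p γ (a + b) ≤ tirNorm p γ a + tirNorm p γ b :=
  ciSup_le fun m => (approxNorm_add hp hγ m a b).trans
    (add_le_add (approxNorm_le_tirNorm hp hγ m a) (approxNorm_le_tirNorm hp hγ m b))

lemma tirNorm_smul_le (hp : 1 < p) (hγ : γ ∈ Set.Ioo (0 : ℝ) 1) (c : ℝ) (a : ℕ →₀ ℝ) :
    tirNorm p γ (c • a) ≤ |c| * tirNorm p γ a :=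
  ciSup_le fun m => (approxNorm_smul_le hp hγ c m a).trans
    (mul_le_mul_of_nonneg_left (approxNorm_le_tirNorm hp hγ m a) (abs_nonneg c))

lemma abs_le_tirNorm (hp : 1 < p) (hγ : γ ∈ Set.Ioo (0 : ℝ) 1) (a : ℕ →₀ ℝ) (i : ℕ) :
    |a i| ≤ tirNorm p γ a :=
  (abs_le_supNorm a i).trans (approxNorm_le_tirNorm hp hγ 0 a)

lemma tirNorm_nonneg (hp : 1 < p) (hγ : γ ∈ Set.Ioo (0 : ℝ) 1) (a : ℕ →₀ ℝ) :
    0 ≤ tirNorm p γ a :=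
  (abs_nonneg _).trans (abs_le_tirNorm hp hγ a 0)

lemma tirNorm_smul (hp : 1 < p) (hγ : γ ∈ Set.Ioo (0 : ℝ) 1) (c : ℝ) (a : ℕ →₀ ℝ) :
    tirNorm p γ (c • a) = |c| * tirNorm p γ a := by
  refine le_antisymm (tirNorm_smul_le hp hγ c a) ?_
  rcases eq_or_ne c 0 with rfl | hc
  · simpa using tirNorm_nonneg hp hγ 0
  · have h := tirNorm_smul_le hp hγ c⁻¹ (c • a)
    rw [smul_smul, inv_mul_cancel₀ hc, one_smul, abs_inv] at h
    rwa [← le_inv_mul_iff₀ (abs_pos.2 hc)]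

/-! ### The Tirilman space -/

/-- The space `c₀₀` of finitely supported real sequences, to be normed by `tirNorm p γ`. -/
def PreTi (p γ : ℝ) (_hp : 1 < p) (_hγ : γ ∈ Set.Ioo (0 : ℝ) 1) : Type := ℕ →₀ ℝ

variable (hp : 1 < p) (hγ : γ ∈ Set.Ioo (0 : ℝ) 1)

instance : AddCommGroup (PreTi p γ hp hγ) := inferInstanceAs (AddCommGroup (ℕ →₀ ℝ))

instance : Module ℝ (PreTi p γ hp hγ) := inferInstanceAs (Module ℝ (ℕ →₀ ℝ))

instance : Norm (PreTi p γ hp hγ) := ⟨fun a => tirNorm p γ a⟩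

lemma PreTi.core : NormedSpace.Core ℝ (PreTi p γ hp hγ) where
  norm_nonneg a := tirNorm_nonneg hp hγ a
  norm_smul c a := tirNorm_smul hp hγ c a
  norm_triangle a b := tirNorm_add hp hγ a b
  norm_eq_zero_iff a := by
    constructor
    · intro h
      refine Finsupp.ext fun i => ?_
      have h1 := abs_le_tirNorm hp hγ a i
      have h2 : tirNorm p γ a = 0 := h
      rw [h2] at h1
      exact abs_nonpos_iff.1 h1
    · rintro rfl
      refine le_antisymm ((tirNorm_le_oneNorm hp hγ 0).trans ?_) (tirNorm_nonneg hp hγ 0)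
      simp [oneNorm]

instance : NormedAddCommGroup (PreTi p γ hp hγ) := NormedAddCommGroup.ofCore (PreTi.core hp hγ)

instance : NormedSpace ℝ (PreTi p γ hp hγ) := NormedSpace.ofCore (PreTi.core hp hγ)

end Tirilman

/-- The Tirilman space `Ti(p, γ)`: the completion of `c₀₀` in the norm `Tirilman.tirNorm p γ`. -/
abbrev Ti (p γ : ℝ) (hp : 1 < p) (hγ : γ ∈ Set.Ioo (0 : ℝ) 1) : Type :=
  UniformSpace.Completion (Tirilman.PreTi p γ hp hγ)

/-- `Y` contains an isomorphic copy of `X`: some linear subspace of `Y`, with the norm of `Y`,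
is linearly homeomorphic to `X`. -/
def ContainsIsomorphicCopy (Y X : Type*) [NormedAddCommGroup Y] [NormedSpace ℝ Y]
    [NormedAddCommGroup X] [NormedSpace ℝ X] : Prop :=
  ∃ Z : Submodule ℝ Y, Nonempty (X ≃L[ℝ] Z)

end

/-!
The argument plays lower against upper `ℓ_p` estimates of block sequences in `c₀₀`.

*Upper estimates.* Consider the action of `n` consecutive sets `E_1 < ⋯ < E_n` on a combination
of blocks. The blocks that are hit by at least two of the sets number at most `n`, and receive at
most `2 n` hits (`IsBlockSeq.sum_card_hits_le`). Each remaining block is hit by at most one set, and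
is kept whole at the cost of a factor `γ < 1` (`IsBlockSeq.exists_cut`). By induction along the
approximating norms, every bounded block sequence has an upper `ℓ_p` estimate
(`IsBlockSeq.exists_upper_estimate`).

*No lower estimates.* Let `C` be the constant of an upper `ℓ_p` estimate of the blocks `x i`, and
pass to flat `ℓ_p`-normalized averages over intervals of rapidly increasing lengths. For each `n`,
at most one of these averages has a length comparable with `n`: the shorter ones are small even
in `ℓ₁` after division by `n ^ (1 / q)`, and of the longer ones only a negligible part is cut. Hence
the norm of a combination with coefficients `a` is at most `γ C ‖a‖_p + 3 C ‖a‖_∞`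
(`IsBlockSeq.exists_flat_upper_estimate`). A second flat averaging removes the supremum term, and
replaces `C` by `C (1 + γ) / 2`. Since `ℓ_p`-normalized averaging preserves lower `ℓ_p` estimates,
iterating this rules them out (`IsBlockSeq.not_lower_estimate`).

*Duality.* If `ℓ_q` embeds into the dual space, the images `f i` of the unit vectors have an upper
`ℓ_q` estimate and norms bounded below. They tend to zero pointwise, so a gliding hump yields a
bounded block sequence `x j` with `f (φ j) (x j)` bounded below. Unconditionality of the unit vectors
allows a choice of signs for which the off-diagonal terms `f (φ i) (x j)` contribute nonnegatively,
and `x` has a lower `ℓ_p` estimate (`IsBlockSeq.lower_estimate_of_functionals`), a contradiction.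
-/

noncomputable section

namespace Tirilman

/-! ### Lattice properties of the Tirilman norm -/

section Lattice

variable {p γ : ℝ}

lemma restrict_apply (E : Finset ℕ) (a : ℕ →₀ ℝ) (i : ℕ) [Decidable (i ∈ E)] :
    restrict E a i = if i ∈ E then a i else 0 := by
  classical
  simp only [restrict, Finsupp.filter_apply]
  congr

lemma abs_restrict_le (E : Finset ℕ) (a : ℕ →₀ ℝ) (i : ℕ) : |restrict E a i| ≤ |a i| := by
  classical
  rw [restrict_apply]
  split_ifs <;> simp

lemma conj_inv_pos (hp : 1 < p) : 0 < 1 / p.conjExponent := by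
  have : 0 < p.conjExponent := (Real.HolderConjugate.conjExponent hp).symm.pos
  positivity

/-- The approximating norms depend on the absolute values of the coordinates only, and
monotonically so: the unit vectors form a `1`-unconditional basis. -/
lemma approxNorm_le_of_abs_le (hp : 1 < p) (hγ : γ ∈ Set.Ioo (0 : ℝ) 1) (m : ℕ) :
    ∀ {a b : ℕ →₀ ℝ}, (∀ i, |a i| ≤ |b i|) → approxNorm p γ m a ≤ approxNorm p γ m b := by
  have hsup : ∀ {a b : ℕ →₀ ℝ}, (∀ i, |a i| ≤ |b i|) → supNorm a ≤ supNorm b :=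
    fun h => ciSup_le fun i => (h i).trans (abs_le_supNorm _ i)
  induction m with
  | zero => exact hsup
  | succ m ih =>
    intro a b h
    refine max_le_max (hsup h) (mul_le_mul_of_nonneg_left ?_ hγ.1.le)
    refine csSup_le (admissibleValues_nonempty _ _) ?_
    rintro _ ⟨n, E, hn, hE, rfl⟩
    refine le_trans ?_ (le_csSup (admissibleValues_bdd hp (approxNorm_le_oneNorm hp hγ m) b)
      ⟨n, E, hn, hE, rfl⟩)
    gcongr with j
    refine ih fun i => ?_
    classical
    simp only [restrict_apply]
    split_ifs
    · exact h i
    · exact le_rfl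

lemma tirNorm_le_of_abs_le (hp : 1 < p) (hγ : γ ∈ Set.Ioo (0 : ℝ) 1) {a b : ℕ →₀ ℝ}
    (h : ∀ i, |a i| ≤ |b i|) : tirNorm p γ a ≤ tirNorm p γ b :=
  ciSup_le fun m => (approxNorm_le_of_abs_le hp hγ m h).trans (approxNorm_le_tirNorm hp hγ m b)

lemma approxNorm_restrict_le (hp : 1 < p) (hγ : γ ∈ Set.Ioo (0 : ℝ) 1) (m : ℕ) (E : Finset ℕ)
    (a : ℕ →₀ ℝ) : approxNorm p γ m (restrict E a) ≤ approxNorm p γ m a :=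
  approxNorm_le_of_abs_le hp hγ m (abs_restrict_le E a)

lemma tirNorm_restrict_le (hp : 1 < p) (hγ : γ ∈ Set.Ioo (0 : ℝ) 1) (E : Finset ℕ)
    (a : ℕ →₀ ℝ) : tirNorm p γ (restrict E a) ≤ tirNorm p γ a :=
  tirNorm_le_of_abs_le hp hγ (abs_restrict_le E a)

lemma approxNorm_nonneg (m : ℕ) (a : ℕ →₀ ℝ) : 0 ≤ approxNorm p γ m a :=
  (supNorm_nonneg a).trans (supNorm_le_approxNorm m a)

lemma approxNorm_zero (hp : 1 < p) (hγ : γ ∈ Set.Ioo (0 : ℝ) 1) (m : ℕ) :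
    approxNorm p γ m 0 = 0 :=
  le_antisymm ((approxNorm_le_oneNorm hp hγ m 0).trans (by simp [oneNorm]))
    (approxNorm_nonneg m 0)

lemma approxNorm_sum_le (hp : 1 < p) (hγ : γ ∈ Set.Ioo (0 : ℝ) 1) (m : ℕ) {ι : Type*}
    (F : Finset ι) (g : ι → ℕ →₀ ℝ) :
    approxNorm p γ m (∑ i ∈ F, g i) ≤ ∑ i ∈ F, approxNorm p γ m (g i) :=
  Finset.le_sum_of_subadditive _ (approxNorm_zero hp hγ m).le (approxNorm_add hp hγ m) F g

lemma oneNorm_add_le (a b : ℕ →₀ ℝ) : oneNorm (a + b) ≤ oneNorm a + oneNorm b := by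
  classical
  rw [oneNorm_eq (a + b) Finsupp.support_add,
    oneNorm_eq a (Finset.subset_union_left (s₂ := b.support)),
    oneNorm_eq b (Finset.subset_union_right (s₁ := a.support)), ← Finset.sum_add_distrib]
  exact Finset.sum_le_sum fun i _ => abs_add_le _ _

lemma oneNorm_smul_le (c : ℝ) (a : ℕ →₀ ℝ) : oneNorm (c • a) ≤ |c| * oneNorm a := by
  rw [oneNorm_eq (c • a) Finsupp.support_smul, oneNorm, Finset.mul_sum]
  exact Finset.sum_le_sum fun i _ => by simp [abs_mul]

/-- Any subfamily of a consecutive family is admissible. -/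
lemma mul_sum_approxNorm_restrict_le (hp : 1 < p) (hγ : γ ∈ Set.Ioo (0 : ℝ) 1) (m : ℕ) {n : ℕ}
    {E : Fin n → Finset ℕ} (hE : Consecutive E) (J : Finset (Fin n)) (a : ℕ →₀ ℝ) :
    γ * ∑ s ∈ J, approxNorm p γ m (restrict (E s) a) ≤
      (J.card : ℝ) ^ (1 / p.conjExponent) * tirNorm p γ a := by
  rcases J.eq_empty_or_nonempty with rfl | hJ
  · simpa using mul_nonneg (Real.rpow_nonneg le_rfl _) (tirNorm_nonneg hp hγ a)
  have hcard : 1 ≤ J.card := hJ.card_pos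
  have hsum : ∑ s ∈ J, approxNorm p γ m (restrict (E s) a) =
      ∑ j, approxNorm p γ m (restrict (E (J.orderEmbOfFin rfl j)) a) := by
    have h := Finset.sum_map Finset.univ (J.orderEmbOfFin rfl).toEmbedding
      fun s => approxNorm p γ m (restrict (E s) a)
    rw [Finset.map_orderEmbOfFin_univ] at h
    exact h
  have hpos : 0 < (J.card : ℝ) ^ (1 / p.conjExponent) :=
    zero_lt_one.trans_le (one_le_rpow hp hcard)
  have h := le_csSup (admissibleValues_bdd hp (approxNorm_le_oneNorm (γ := γ) hp hγ m) a)
    ⟨J.card, fun j => E (J.orderEmbOfFin rfl j), hcard,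
      ⟨fun j => hE.1 _, fun i j hij => hE.2 _ _ (by simpa using hij)⟩, rfl⟩
  rw [← hsum, div_le_iff₀ hpos] at h
  have h2 : γ * sSup (admissibleValues p (approxNorm p γ m) a) ≤ tirNorm p γ a :=
    (le_max_right _ _).trans (approxNorm_le_tirNorm hp hγ (m + 1) a)
  calc γ * ∑ s ∈ J, approxNorm p γ m (restrict (E s) a)
      ≤ γ * (sSup (admissibleValues p (approxNorm p γ m) a) *
          (J.card : ℝ) ^ (1 / p.conjExponent)) := mul_le_mul_of_nonneg_left h hγ.1.le
    _ = (J.card : ℝ) ^ (1 / p.conjExponent) *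
          (γ * sSup (admissibleValues p (approxNorm p γ m) a)) := by ring
    _ ≤ _ := mul_le_mul_of_nonneg_left h2 hpos.le

lemma approxNorm_succ_le (hp : 1 < p) (hγ : γ ∈ Set.Ioo (0 : ℝ) 1) {m : ℕ} {a : ℕ →₀ ℝ} {R : ℝ}
    (h0 : supNorm a ≤ R)
    (h : ∀ (n : ℕ) (E : Fin n → Finset ℕ), 1 ≤ n → Consecutive E →
      γ * ∑ s, approxNorm p γ m (restrict (E s) a) ≤ (n : ℝ) ^ (1 / p.conjExponent) * R) :
    approxNorm p γ (m + 1) a ≤ R := by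
  refine max_le h0 ?_
  rw [← le_div_iff₀' hγ.1]
  refine csSup_le (admissibleValues_nonempty _ a) ?_
  rintro _ ⟨n, E, hn, hE, rfl⟩
  rw [div_le_iff₀ (zero_lt_one.trans_le (one_le_rpow hp hn)), div_mul_eq_mul_div,
    le_div_iff₀' hγ.1, mul_comm R]
  exact h n E hn hE

lemma tirNorm_le (hp : 1 < p) (hγ : γ ∈ Set.Ioo (0 : ℝ) 1) {a : ℕ →₀ ℝ} {R : ℝ}
    (h0 : supNorm a ≤ R)
    (h : ∀ (m n : ℕ) (E : Fin n → Finset ℕ), 1 ≤ n → Consecutive E →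
      γ * ∑ s, approxNorm p γ m (restrict (E s) a) ≤ (n : ℝ) ^ (1 / p.conjExponent) * R) :
    tirNorm p γ a ≤ R :=
  ciSup_le fun m => (approxNorm_le_succ hp hγ m a).trans (approxNorm_succ_le hp hγ h0 (h m))

end Lattice

/-! ### The `ℓ_p` norm of coefficients -/

section PNorm

/-- The `ℓ_p` norm on `c₀₀`. -/
def pNorm (p : ℝ) (b : ℕ →₀ ℝ) : ℝ := (∑ i ∈ b.support, |b i| ^ p) ^ (1 / p)

variable {p : ℝ}

lemma sum_support_rpow (hp : 1 < p) (b : ℕ →₀ ℝ) {F : Finset ℕ} (h : b.support ⊆ F) :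
    ∑ i ∈ b.support, |b i| ^ p = ∑ i ∈ F, |b i| ^ p :=
  Finset.sum_subset h fun i _ hi => by
    rw [Finsupp.notMem_support_iff.1 hi, abs_zero, Real.zero_rpow (by linarith)]

lemma sum_rpow_nonneg (b : ℕ →₀ ℝ) (F : Finset ℕ) : 0 ≤ ∑ i ∈ F, |b i| ^ p :=
  Finset.sum_nonneg fun _ _ => Real.rpow_nonneg (abs_nonneg _) _

lemma pNorm_nonneg (b : ℕ →₀ ℝ) : 0 ≤ pNorm p b := Real.rpow_nonneg (sum_rpow_nonneg _ _) _

lemma pNorm_rpow (hp : 1 < p) (b : ℕ →₀ ℝ) :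
    pNorm p b ^ p = ∑ i ∈ b.support, |b i| ^ p := by
  rw [pNorm, one_div, Real.rpow_inv_rpow (sum_rpow_nonneg _ _) (by linarith)]

lemma abs_le_pNorm (hp : 1 < p) (b : ℕ →₀ ℝ) (i : ℕ) : |b i| ≤ pNorm p b := by
  by_cases hi : i ∈ b.support
  · rw [← Real.rpow_le_rpow_iff (abs_nonneg _) (pNorm_nonneg b) (by linarith : 0 < p),
      pNorm_rpow hp]
    exact Finset.single_le_sum (f := fun i => |b i| ^ p)
      (fun _ _ => Real.rpow_nonneg (abs_nonneg _) _) hi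
  · simpa [Finsupp.notMem_support_iff.1 hi] using pNorm_nonneg (p := p) b

lemma pNorm_single (hp : 1 < p) (i : ℕ) (c : ℝ) : pNorm p (Finsupp.single i c) = |c| := by
  have h0 : p ≠ 0 := by linarith
  rw [pNorm, sum_support_rpow hp _ Finsupp.support_single_subset, Finset.sum_singleton,
    Finsupp.single_eq_same, one_div, Real.rpow_rpow_inv (abs_nonneg c) h0]

lemma pNorm_restrict_le (hp : 1 < p) (F : Finset ℕ) (b : ℕ →₀ ℝ) :
    pNorm p (restrict F b) ≤ pNorm p b := by
  classical
  refine Real.rpow_le_rpow (sum_rpow_nonneg _ _) ?_ (by positivity)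
  have hs : (restrict F b).support ⊆ b.support := by
    intro i hi
    rw [Finsupp.mem_support_iff] at hi ⊢
    intro h0
    exact hi (by simp [restrict_apply, h0])
  rw [sum_support_rpow hp _ hs]
  exact Finset.sum_le_sum fun i _ =>
    Real.rpow_le_rpow (abs_nonneg _) (abs_restrict_le F b i) (by linarith)

/-- Hölder's inequality for pieces of a sequence with disjoint supports. -/
lemma sum_pNorm_restrict_le (hp : 1 < p) (b : ℕ →₀ ℝ) {n : ℕ} {B : Fin n → Finset ℕ}
    (hB : Pairwise fun s t => Disjoint (B s) (B t)) :
    ∑ s, pNorm p (restrict (B s) b) ≤ (n : ℝ) ^ (1 / p.conjExponent) * pNorm p b := by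
  classical
  have h := Real.inner_le_Lp_mul_Lq Finset.univ (fun s => pNorm p (restrict (B s) b))
    (fun _ : Fin n => (1 : ℝ)) (Real.HolderConjugate.conjExponent hp)
  simp only [mul_one, abs_one, Real.one_rpow, Finset.sum_const, Finset.card_univ,
    Fintype.card_fin, nsmul_eq_mul] at h
  refine h.trans ?_
  rw [mul_comm]
  refine mul_le_mul_of_nonneg_left ?_ (by positivity)
  refine Real.rpow_le_rpow (Finset.sum_nonneg fun _ _ => by positivity) ?_
    (by have := hp; positivity)
  have h1 : ∀ s, |pNorm p (restrict (B s) b)| ^ p =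
      ∑ i ∈ b.support, if i ∈ B s then |b i| ^ p else 0 := by
    intro s
    have hs : (restrict (B s) b).support ⊆ b.support := by
      intro i hi
      rw [Finsupp.mem_support_iff] at hi ⊢
      intro h0
      exact hi (by simp [restrict_apply, h0])
    rw [abs_of_nonneg (pNorm_nonneg _), pNorm_rpow hp, sum_support_rpow hp _ hs]
    refine Finset.sum_congr rfl fun i _ => ?_
    rw [restrict_apply]
    split_ifs
    · rfl
    · rw [abs_zero, Real.zero_rpow (by linarith)]
  simp_rw [h1]
  rw [Finset.sum_comm]
  refine Finset.sum_le_sum fun i _ => ?_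
  have h0 : 0 ≤ |b i| ^ p := Real.rpow_nonneg (abs_nonneg _) _
  by_cases hi : ∃ s, i ∈ B s
  · obtain ⟨s, hs⟩ := hi
    rw [Finset.sum_eq_single s]
    · simp [hs]
    · intro t _ ht
      rw [if_neg fun hit => Finset.disjoint_left.1 (hB ht) hit hs]
    · simp
  · push Not at hi
    simpa [hi] using h0

lemma sum_abs_mul_rpow_le (hp : 1 < p) (b : ℕ →₀ ℝ) {A : Finset ℕ} (hA : A ⊆ b.support)
    (ν : ℕ → ℕ) :
    ∑ i ∈ A, |b i| * (ν i : ℝ) ^ (1 / p.conjExponent) ≤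
      ((∑ i ∈ A, ν i : ℕ) : ℝ) ^ (1 / p.conjExponent) * pNorm p b := by
  have hc := (Real.HolderConjugate.conjExponent hp)
  have hθ := conj_inv_pos hp
  have h := Real.inner_le_Lp_mul_Lq A (fun i => |b i|)
    (fun i => (ν i : ℝ) ^ (1 / p.conjExponent)) hc
  refine h.trans ?_
  rw [mul_comm]
  have h1 : ∀ i, |(ν i : ℝ) ^ (1 / p.conjExponent)| ^ p.conjExponent = ν i := by
    intro i
    rw [abs_of_nonneg (by positivity), one_div, Real.rpow_inv_rpow (by positivity)
      hc.symm.pos.ne']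
  simp only [h1, abs_abs, Nat.cast_sum]
  refine mul_le_mul_of_nonneg_left ?_ (by positivity)
  exact Real.rpow_le_rpow (sum_rpow_nonneg _ _) (Finset.sum_le_sum_of_subset_of_nonneg hA
    fun i _ _ => Real.rpow_nonneg (abs_nonneg _) _) (by positivity)

end PNorm

/-! ### Block sequences and how a consecutive family cuts them -/

section Blocks

variable {p γ : ℝ}

/-- `x 0 < x 1 < ⋯`: the supports of the `x i` are successive. Zero vectors are allowed. -/
def IsBlockSeq (x : ℕ → ℕ →₀ ℝ) : Prop :=
  ∀ i j, i < j → ∀ k ∈ (x i).support, ∀ l ∈ (x j).support, k < l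

/-- The linear combination `∑ i, b i • x i`. -/
abbrev comb (x : ℕ → ℕ →₀ ℝ) (b : ℕ →₀ ℝ) : ℕ →₀ ℝ := Finsupp.linearCombination ℝ x b

lemma comb_eq_sum (x : ℕ → ℕ →₀ ℝ) (b : ℕ →₀ ℝ) {F : Finset ℕ} (h : b.support ⊆ F) :
    comb x b = ∑ i ∈ F, b i • x i := by
  rw [comb, Finsupp.linearCombination_apply, Finsupp.sum]
  exact Finset.sum_subset h fun i _ hi => by simp [Finsupp.notMem_support_iff.1 hi]

/-- At every coordinate at most one member of a block sequence is nonzero. -/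
lemma IsBlockSeq.exists_comb_apply {x : ℕ → ℕ →₀ ℝ} (hx : IsBlockSeq x) (k : ℕ) :
    ∃ i, ∀ b, comb x b k = b i * x i k := by
  have key : ∀ i, (∀ j, j ≠ i → x j k = 0) → ∀ b, comb x b k = b i * x i k := by
    intro i hi b
    rw [comb_eq_sum x b (Finset.subset_insert i b.support), Finsupp.finsetSum_apply,
      Finset.sum_eq_single i]
    · simp
    · intro j _ hj
      simp [hi j hj]
    · simp
  by_cases h : ∃ i, x i k ≠ 0
  · obtain ⟨i, hi⟩ := h
    refine ⟨i, key i fun j hj => ?_⟩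
    by_contra hjk
    rcases lt_or_gt_of_ne hj with hlt | hlt
    · exact lt_irrefl k (hx _ _ hlt k (Finsupp.mem_support_iff.2 hjk) k
        (Finsupp.mem_support_iff.2 hi))
    · exact lt_irrefl k (hx _ _ hlt k (Finsupp.mem_support_iff.2 hi) k
        (Finsupp.mem_support_iff.2 hjk))
  · push Not at h
    exact ⟨0, key 0 fun j _ => h j⟩

lemma IsBlockSeq.supNorm_comb_le (hp : 1 < p) (hγ : γ ∈ Set.Ioo (0 : ℝ) 1)
    {x : ℕ → ℕ →₀ ℝ} (hx : IsBlockSeq x) {D τ : ℝ} (hD : ∀ i, tirNorm p γ (x i) ≤ D)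
    {b : ℕ →₀ ℝ} (hb : ∀ i, |b i| ≤ τ) : supNorm (comb x b) ≤ τ * D := by
  refine ciSup_le fun k => ?_
  obtain ⟨i, hi⟩ := hx.exists_comb_apply k
  rw [hi b, abs_mul]
  exact mul_le_mul (hb i) ((abs_le_tirNorm hp hγ (x i) k).trans (hD i)) (abs_nonneg _)
    ((abs_nonneg _).trans (hb i))

lemma IsBlockSeq.tirNorm_comb_le_of_abs_le (hp : 1 < p) (hγ : γ ∈ Set.Ioo (0 : ℝ) 1)
    {x : ℕ → ℕ →₀ ℝ} (hx : IsBlockSeq x) {b c : ℕ →₀ ℝ} (h : ∀ i, |b i| ≤ |c i|) :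
    tirNorm p γ (comb x b) ≤ tirNorm p γ (comb x c) := by
  refine tirNorm_le_of_abs_le hp hγ fun k => ?_
  obtain ⟨i, hi⟩ := hx.exists_comb_apply k
  rw [hi b, hi c, abs_mul, abs_mul]
  exact mul_le_mul_of_nonneg_right (h i) (abs_nonneg _)

/-- The indices of the sets of the family `E` that meet the support of `y`. -/
def hits {n : ℕ} (E : Fin n → Finset ℕ) (y : ℕ →₀ ℝ) : Finset (Fin n) :=
  Finset.univ.filter fun s => (E s ∩ y.support).Nonempty

lemma mem_hits {n : ℕ} {E : Fin n → Finset ℕ} {y : ℕ →₀ ℝ} {s : Fin n} :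
    s ∈ hits E y ↔ ∃ k ∈ E s, y k ≠ 0 := by
  simp [hits, Finset.Nonempty]

lemma restrict_eq_zero_of_notMem_hits {n : ℕ} {E : Fin n → Finset ℕ} {y : ℕ →₀ ℝ} {s : Fin n}
    (h : s ∉ hits E y) : restrict (E s) y = 0 := by
  classical
  rw [mem_hits] at h
  push Not at h
  ext k
  rw [restrict_apply]
  split_ifs with hk
  · exact h k hk
  · rfl

/-- The blocks cut by a consecutive family of `n` sets, that is, hit by at least two of them,
receive at most `2 n` hits in total: after removing the last hit of each cut block, no set
hits two different blocks. -/
lemma IsBlockSeq.sum_card_hits_le {x : ℕ → ℕ →₀ ℝ} (hx : IsBlockSeq x) {n : ℕ}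
    {E : Fin n → Finset ℕ} (hE : Consecutive E) (A : Finset ℕ)
    (hA : ∀ i ∈ A, 2 ≤ (hits E (x i)).card) :
    ∑ i ∈ A, (hits E (x i)).card ≤ 2 * n := by
  classical
  set J : ℕ → Finset (Fin n) := fun i => hits E (x i) with hJ
  let J' : ℕ → Finset (Fin n) := fun i => (J i).filter fun s => ∃ t ∈ J i, s < t
  have hne : ∀ i ∈ A, (J i).Nonempty := fun i hi =>
    Finset.card_pos.1 (zero_lt_two.trans_le (hA i hi))
  have hcard : ∀ i ∈ A, (J i).card ≤ 2 * (J' i).card := by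
    intro i hi
    have hsub : (J i).erase ((J i).max' (hne i hi)) ⊆ J' i := by
      intro s hs
      rw [Finset.mem_erase] at hs
      exact Finset.mem_filter.2 ⟨hs.2, _, Finset.max'_mem _ (hne i hi),
        lt_of_le_of_ne (Finset.le_max' _ _ hs.2) hs.1⟩
    have h1 := Finset.card_le_card hsub
    rw [Finset.card_erase_of_mem (Finset.max'_mem _ _)] at h1
    have h2 := hA i hi
    change 2 ≤ (J i).card at h2
    omega
  have haux : ∀ i j, i < j → Disjoint (J' i) (J' j) := by
    intro i j hij
    refine Finset.disjoint_left.2 fun s hs hs' => ?_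
    obtain ⟨-, t, ht, hst⟩ := Finset.mem_filter.1 hs
    obtain ⟨k, hk, hxk⟩ := mem_hits.1 ht
    obtain ⟨l, hl, hxl⟩ := mem_hits.1 (Finset.mem_filter.1 hs').1
    exact lt_asymm (hE.2 s t hst l hl k hk)
      (hx i j hij k (Finsupp.mem_support_iff.2 hxk) l (Finsupp.mem_support_iff.2 hxl))
  have hdisj : (A : Set ℕ).PairwiseDisjoint J' := by
    intro i _ j _ hij
    rcases lt_or_gt_of_ne hij with h | h
    · exact haux i j h
    · exact (haux j i h).symm
  calc ∑ i ∈ A, (J i).card ≤ ∑ i ∈ A, 2 * (J' i).card := Finset.sum_le_sum hcard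
    _ = 2 * (A.biUnion J').card := by rw [Finset.card_biUnion hdisj, Finset.mul_sum]
    _ ≤ 2 * n := by
      have := Finset.card_le_univ (A.biUnion J')
      rw [Fintype.card_fin] at this
      omega

/-- How a consecutive family acts on a combination of blocks: the blocks `i ∈ A` that it cuts
are estimated one by one, and each of the others is assigned to the only set that hits it, if
there is one. -/
lemma IsBlockSeq.exists_cut (hp : 1 < p) (hγ : γ ∈ Set.Ioo (0 : ℝ) 1) {x : ℕ → ℕ →₀ ℝ}
    (hx : IsBlockSeq x) {n : ℕ} {E : Fin n → Finset ℕ} (hE : Consecutive E) (b : ℕ →₀ ℝ) :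
    ∃ (A : Finset ℕ) (ν : ℕ → ℕ) (B : Fin n → Finset ℕ), A ⊆ b.support ∧ A.card ≤ n ∧
      (∀ i, ν i ≤ n) ∧ ∑ i ∈ A, ν i ≤ 2 * n ∧ (Pairwise fun s t => Disjoint (B s) (B t)) ∧
      ∀ m, γ * ∑ s, approxNorm p γ m (restrict (E s) (comb x b)) ≤
        γ * ∑ s, approxNorm p γ m (comb x (restrict (B s) b)) +
          ∑ i ∈ A, |b i| * ((ν i : ℝ) ^ (1 / p.conjExponent) * tirNorm p γ (x i)) := by
  classical
  set A := b.support.filter fun i => 2 ≤ (hits E (x i)).card with hA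
  set B : Fin n → Finset ℕ := fun s => b.support.filter fun i => hits E (x i) = {s} with hB
  have hsum := hx.sum_card_hits_le hE A fun i hi => (Finset.mem_filter.1 hi).2
  refine ⟨A, fun i => (hits E (x i)).card, B, Finset.filter_subset _ _, ?_, ?_, hsum, ?_, ?_⟩
  · have h : ∑ i ∈ A, 2 ≤ ∑ i ∈ A, (hits E (x i)).card :=
      Finset.sum_le_sum fun i hi => (Finset.mem_filter.1 hi).2
    rw [Finset.sum_const, smul_eq_mul] at h
    omega
  · intro i
    simpa using Finset.card_le_univ (hits E (x i))
  · intro s t hst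
    refine Finset.disjoint_left.2 fun i hi hi' => hst ?_
    have h1 := (Finset.mem_filter.1 hi).2
    rw [(Finset.mem_filter.1 hi').2] at h1
    exact (Finset.singleton_injective h1).symm
  · intro m
    have hsplit : ∀ s, restrict (E s) (comb x b) =
        restrict (E s) (comb x (restrict (B s) b)) + ∑ i ∈ A, b i • restrict (E s) (x i) := by
      intro s
      have hAsum : ∑ i ∈ A, b i • restrict (E s) (x i) =
          restrict (E s) (comb x (restrict A b)) := by
        have hsupp : (restrict A b).support ⊆ A := by
          intro i hi
          rw [Finsupp.mem_support_iff, restrict_apply] at hi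
          by_contra h
          exact hi (if_neg h)
        rw [comb_eq_sum x _ hsupp]
        have hlin : ∀ F : Finset ℕ, ∀ g : ℕ → ℕ →₀ ℝ,
            restrict (E s) (∑ i ∈ F, g i) = ∑ i ∈ F, restrict (E s) (g i) := fun F g =>
          map_sum (AddMonoidHom.mk' (restrict (E s)) (restrict_add (E s))) g F
        rw [hlin]
        refine Finset.sum_congr rfl fun i hi => ?_
        rw [restrict_smul, restrict_apply, if_pos hi]
      rw [hAsum]
      ext k
      rw [Finsupp.add_apply, restrict_apply, restrict_apply, restrict_apply]
      by_cases hk : k ∈ E s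
      · rw [if_pos hk, if_pos hk, if_pos hk]
        obtain ⟨i, hi⟩ := hx.exists_comb_apply k
        rw [hi, hi, hi, restrict_apply, restrict_apply]
        by_cases hbi : b i = 0
        · simp [hbi]
        by_cases hxi : x i k = 0
        · simp [hxi]
        have hs : s ∈ hits E (x i) := mem_hits.2 ⟨k, hk, hxi⟩
        have hbs : i ∈ b.support := Finsupp.mem_support_iff.2 hbi
        by_cases hc : 2 ≤ (hits E (x i)).card
        · have h1 : i ∈ A := Finset.mem_filter.2 ⟨hbs, hc⟩
          have h2 : i ∉ B s := by
            intro h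
            rw [(Finset.mem_filter.1 h).2, Finset.card_singleton] at hc
            omega
          rw [if_pos h1, if_neg h2]
          ring
        · have h1 : i ∉ A := fun h => hc (Finset.mem_filter.1 h).2
          have h2 : i ∈ B s := by
            refine Finset.mem_filter.2 ⟨hbs, ?_⟩
            refine (Finset.eq_of_subset_of_card_le (Finset.singleton_subset_iff.2 hs) ?_).symm
            rw [Finset.card_singleton]
            omega
          rw [if_neg h1, if_pos h2]
          ring
      · simp [hk]
    have hone : ∀ s, approxNorm p γ m (restrict (E s) (comb x b)) ≤
        approxNorm p γ m (comb x (restrict (B s) b)) +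
          ∑ i ∈ A, |b i| * approxNorm p γ m (restrict (E s) (x i)) := by
      intro s
      rw [hsplit s]
      refine (approxNorm_add hp hγ m _ _).trans
        (add_le_add (approxNorm_restrict_le hp hγ m _ _) ?_)
      exact (approxNorm_sum_le hp hγ m _ _).trans
        (Finset.sum_le_sum fun i _ => approxNorm_smul_le hp hγ _ m _)
    calc γ * ∑ s, approxNorm p γ m (restrict (E s) (comb x b))
        ≤ γ * ∑ s, (approxNorm p γ m (comb x (restrict (B s) b)) +
          ∑ i ∈ A, |b i| * approxNorm p γ m (restrict (E s) (x i))) :=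
          mul_le_mul_of_nonneg_left (Finset.sum_le_sum fun s _ => hone s) hγ.1.le
      _ = γ * ∑ s, approxNorm p γ m (comb x (restrict (B s) b)) +
          ∑ i ∈ A, |b i| * (γ * ∑ s, approxNorm p γ m (restrict (E s) (x i))) := by
        rw [Finset.sum_add_distrib, mul_add, Finset.sum_comm]
        congr 1
        rw [Finset.mul_sum]
        refine Finset.sum_congr rfl fun i _ => ?_
        rw [← Finset.mul_sum]
        ring
      _ ≤ _ := by
        refine add_le_add le_rfl (Finset.sum_le_sum fun i _ =>
          mul_le_mul_of_nonneg_left ?_ (abs_nonneg _))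
        have hz : ∑ s, approxNorm p γ m (restrict (E s) (x i)) =
            ∑ s ∈ hits E (x i), approxNorm p γ m (restrict (E s) (x i)) := by
          refine (Finset.sum_subset (Finset.subset_univ _) fun s _ hs => ?_).symm
          rw [restrict_eq_zero_of_notMem_hits hs, approxNorm_zero hp hγ]
        rw [hz]
        exact mul_sum_approxNorm_restrict_le hp hγ m hE _ _

/-! ### The upper `ℓ_p` estimate for blocks -/

/-- Bounded block sequences satisfy an upper `ℓ_p` estimate. A norming family loses the factor
`γ` on the blocks it leaves whole, and Hölder's inequality bounds its action on the blocks it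
cuts, so that a constant `C` with `γ C + 2 ^ (1 / q) = C` is preserved by the recursion. -/
lemma IsBlockSeq.exists_upper_estimate (hp : 1 < p) (hγ : γ ∈ Set.Ioo (0 : ℝ) 1)
    {x : ℕ → ℕ →₀ ℝ} (hx : IsBlockSeq x) {D : ℝ} (hD : ∀ i, tirNorm p γ (x i) ≤ D) :
    ∃ C, 0 < C ∧ ∀ b, tirNorm p γ (comb x b) ≤ C * pNorm p b := by
  set θ := 1 / p.conjExponent with hθ
  have hθ0 : 0 < θ := conj_inv_pos hp
  have hD0 : 0 ≤ D := (tirNorm_nonneg hp hγ _).trans (hD 0)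
  set C := (2 : ℝ) ^ θ / (1 - γ) with hC
  have h1γ : 0 < 1 - γ := by linarith [hγ.2]
  have h2 : (1 : ℝ) ≤ 2 ^ θ := Real.one_le_rpow one_le_two hθ0.le
  have hCeq : γ * C + 2 ^ θ = C := by
    rw [hC]
    field_simp
    ring
  have hC1 : 1 ≤ C := by
    rw [hC, le_div_iff₀ h1γ]
    linarith [hγ.1]
  have hmain : ∀ m b, approxNorm p γ m (comb x b) ≤ C * D * pNorm p b := by
    intro m
    have hsup : ∀ b, supNorm (comb x b) ≤ C * D * pNorm p b := by
      intro b
      refine (hx.supNorm_comb_le hp hγ hD (abs_le_pNorm hp b)).trans ?_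
      have := mul_nonneg hD0 (pNorm_nonneg (p := p) b)
      nlinarith
    induction m with
    | zero => exact hsup
    | succ m ih =>
      intro b
      refine approxNorm_succ_le hp hγ (hsup b) fun n E hn hE => ?_
      obtain ⟨A, ν, B, hA, -, -, hν, hB, hcut⟩ := hx.exists_cut hp hγ hE b
      refine (hcut m).trans ?_
      rw [← hθ]
      have hpart1 : ∑ s, approxNorm p γ m (comb x (restrict (B s) b)) ≤
          C * D * ((n : ℝ) ^ θ * pNorm p b) := by
        refine (Finset.sum_le_sum fun s _ => ih (restrict (B s) b)).trans ?_
        rw [← Finset.mul_sum]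
        exact mul_le_mul_of_nonneg_left (sum_pNorm_restrict_le hp b hB)
          (mul_nonneg (by linarith) hD0)
      have hpart2 : ∑ i ∈ A, |b i| * ((ν i : ℝ) ^ θ * tirNorm p γ (x i)) ≤
          2 ^ θ * (n : ℝ) ^ θ * pNorm p b * D := by
        calc ∑ i ∈ A, |b i| * ((ν i : ℝ) ^ θ * tirNorm p γ (x i))
            ≤ ∑ i ∈ A, |b i| * (ν i : ℝ) ^ θ * D := Finset.sum_le_sum fun i _ => by
              rw [mul_assoc]
              gcongr
              exact hD i
          _ = (∑ i ∈ A, |b i| * (ν i : ℝ) ^ θ) * D := by rw [Finset.sum_mul]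
          _ ≤ ((∑ i ∈ A, ν i : ℕ) : ℝ) ^ θ * pNorm p b * D :=
              mul_le_mul_of_nonneg_right (sum_abs_mul_rpow_le hp b hA ν) hD0
          _ ≤ _ := by
            have h3 : ((∑ i ∈ A, ν i : ℕ) : ℝ) ^ θ ≤ 2 ^ θ * (n : ℝ) ^ θ := by
              rw [← Real.mul_rpow zero_le_two (Nat.cast_nonneg n)]
              refine Real.rpow_le_rpow (Nat.cast_nonneg _) ?_ hθ0.le
              exact_mod_cast hν
            have := pNorm_nonneg (p := p) b
            gcongr
      calc _ ≤ γ * (C * D * ((n : ℝ) ^ θ * pNorm p b)) + 2 ^ θ * (n : ℝ) ^ θ * pNorm p b * D :=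
            add_le_add (mul_le_mul_of_nonneg_left hpart1 hγ.1.le) hpart2
        _ = (n : ℝ) ^ θ * ((γ * C + 2 ^ θ) * D * pNorm p b) := by ring
        _ = _ := by rw [hCeq]
  refine ⟨C * D + 1, by positivity, fun b => ciSup_le fun m => (hmain m b).trans ?_⟩
  have := pNorm_nonneg (p := p) b
  nlinarith

end Blocks

/-! ### Flat averages of consecutive terms -/

section Flat

variable {p γ : ℝ}

lemma comb_comb (x y : ℕ → ℕ →₀ ℝ) (b : ℕ →₀ ℝ) :
    comb (fun j => comb x (y j)) b = comb x (comb y b) := by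
  simp only [comb, Finsupp.linearCombination_apply, map_finsuppSum, map_smul,
    Finsupp.linearCombination_apply ℝ (v := y) b]

lemma IsBlockSeq.comp {x y : ℕ → ℕ →₀ ℝ} (hx : IsBlockSeq x) (hy : IsBlockSeq y) :
    IsBlockSeq fun j => comb x (y j) := by
  intro i j hij k hk l hl
  obtain ⟨i', hi'⟩ := hx.exists_comb_apply k
  obtain ⟨j', hj'⟩ := hx.exists_comb_apply l
  rw [Finsupp.mem_support_iff, hi'] at hk
  rw [Finsupp.mem_support_iff, hj'] at hl
  exact hx i' j' (hy i j hij i' (Finsupp.mem_support_iff.2 (left_ne_zero_of_mul hk)) j'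
      (Finsupp.mem_support_iff.2 (left_ne_zero_of_mul hl)))
    k (Finsupp.mem_support_iff.2 (right_ne_zero_of_mul hk)) l
    (Finsupp.mem_support_iff.2 (right_ne_zero_of_mul hl))

/-- The vector with constant coordinates on the interval `[s j, s (j + 1))`, normalized
in `ℓ_p`. -/
def flat (p : ℝ) (s : ℕ → ℕ) (j : ℕ) : ℕ →₀ ℝ :=
  Finsupp.indicator (Finset.Ico (s j) (s (j + 1)))
    fun _ _ => ((s (j + 1) - s j : ℕ) : ℝ) ^ (-(1 / p))

lemma flat_apply (s : ℕ → ℕ) (j i : ℕ) :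
    flat p s j i = if i ∈ Finset.Ico (s j) (s (j + 1)) then
      ((s (j + 1) - s j : ℕ) : ℝ) ^ (-(1 / p)) else 0 := by
  classical
  simp only [flat, Finsupp.indicator_apply]
  congr

lemma mem_Ico_of_flat_ne_zero {s : ℕ → ℕ} {j i : ℕ} (h : flat p s j i ≠ 0) :
    i ∈ Finset.Ico (s j) (s (j + 1)) := by
  rw [flat_apply] at h
  by_contra hi
  exact h (if_neg hi)

lemma isBlockSeq_flat {s : ℕ → ℕ} (hs : StrictMono s) : IsBlockSeq (flat p s) := by
  intro i j hij k hk l hl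
  have h1 := Finset.mem_Ico.1 (mem_Ico_of_flat_ne_zero (Finsupp.mem_support_iff.1 hk))
  have h2 := Finset.mem_Ico.1 (mem_Ico_of_flat_ne_zero (Finsupp.mem_support_iff.1 hl))
  have h3 : s (i + 1) ≤ s j := hs.monotone hij
  omega

lemma comb_flat_apply_of_mem {s : ℕ → ℕ} (hs : StrictMono s) {i j : ℕ}
    (hi : i ∈ Finset.Ico (s j) (s (j + 1))) (a : ℕ →₀ ℝ) :
    comb (flat p s) a i = a j * ((s (j + 1) - s j : ℕ) : ℝ) ^ (-(1 / p)) := by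
  obtain ⟨j', hj'⟩ := (isBlockSeq_flat (p := p) hs).exists_comb_apply i
  have hpos : 0 < s (j + 1) - s j := Nat.sub_pos_of_lt (hs (Nat.lt_succ_self j))
  have h0 : flat p s j i ≠ 0 := by
    rw [flat_apply, if_pos hi]
    positivity
  have h1 := hj' (Finsupp.single j 1)
  rw [comb, Finsupp.linearCombination_single, one_smul] at h1
  have h2 : j = j' := by
    by_contra hne
    rw [Finsupp.single_eq_of_ne (Ne.symm hne), zero_mul] at h1
    exact h0 h1
  rw [hj' a, ← h2, flat_apply, if_pos hi]

lemma exists_mem_of_comb_flat_ne_zero {s : ℕ → ℕ} (hs : StrictMono s) {a : ℕ →₀ ℝ} {i : ℕ}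
    (h : comb (flat p s) a i ≠ 0) : ∃ j ∈ a.support, i ∈ Finset.Ico (s j) (s (j + 1)) := by
  obtain ⟨j, hj⟩ := (isBlockSeq_flat (p := p) hs).exists_comb_apply i
  rw [hj] at h
  exact ⟨j, Finsupp.mem_support_iff.2 (left_ne_zero_of_mul h),
    mem_Ico_of_flat_ne_zero (right_ne_zero_of_mul h)⟩

lemma abs_comb_flat_le {s : ℕ → ℕ} (hs : StrictMono s) {a : ℕ →₀ ℝ} {τ : ℝ} (hτ : 0 ≤ τ)
    (h : ∀ j, |a j| * ((s (j + 1) - s j : ℕ) : ℝ) ^ (-(1 / p)) ≤ τ) (i : ℕ) :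
    |comb (flat p s) a i| ≤ τ := by
  by_cases h0 : comb (flat p s) a i = 0
  · rwa [h0, abs_zero]
  · obtain ⟨j, -, hj⟩ := exists_mem_of_comb_flat_ne_zero hs h0
    rw [comb_flat_apply_of_mem hs hj, abs_mul,
      abs_of_nonneg (Real.rpow_nonneg (Nat.cast_nonneg _) _)]
    exact h j

lemma pNorm_comb_flat (hp : 1 < p) {s : ℕ → ℕ} (hs : StrictMono s) (a : ℕ →₀ ℝ) :
    pNorm p (comb (flat p s) a) = pNorm p a := by
  classical
  have hsub : (comb (flat p s) a).support ⊆
      a.support.biUnion fun j => Finset.Ico (s j) (s (j + 1)) := by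
    intro i hi
    obtain ⟨j, hj, hij⟩ := exists_mem_of_comb_flat_ne_zero hs (Finsupp.mem_support_iff.1 hi)
    exact Finset.mem_biUnion.2 ⟨j, hj, hij⟩
  have haux : ∀ j k, j < k →
      Disjoint (Finset.Ico (s j) (s (j + 1))) (Finset.Ico (s k) (s (k + 1))) := by
    intro j k hjk
    refine Finset.disjoint_left.2 fun i hi hi' => ?_
    have h3 : s (j + 1) ≤ s k := hs.monotone hjk
    rw [Finset.mem_Ico] at hi hi'
    omega
  have hdisj : (a.support : Set ℕ).PairwiseDisjoint fun j => Finset.Ico (s j) (s (j + 1)) := by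
    intro j _ k _ hjk
    rcases lt_or_gt_of_ne hjk with h | h
    · exact haux j k h
    · exact (haux k j h).symm
  rw [pNorm, pNorm, sum_support_rpow hp _ hsub, Finset.sum_biUnion hdisj]
  congr 1
  refine Finset.sum_congr rfl fun j _ => ?_
  have hpos : 0 < s (j + 1) - s j := Nat.sub_pos_of_lt (hs (Nat.lt_succ_self j))
  have hposR : (0 : ℝ) < ((s (j + 1) - s j : ℕ) : ℝ) := by exact_mod_cast hpos
  have hp0 : p ≠ 0 := by linarith
  have hterm : ∀ i ∈ Finset.Ico (s j) (s (j + 1)), |comb (flat p s) a i| ^ p =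
      |a j| ^ p * ((s (j + 1) - s j : ℕ) : ℝ)⁻¹ := by
    intro i hi
    rw [comb_flat_apply_of_mem hs hi, abs_mul, abs_of_nonneg (Real.rpow_nonneg hposR.le _),
      Real.mul_rpow (abs_nonneg _) (Real.rpow_nonneg hposR.le _), ← Real.rpow_mul hposR.le,
      neg_mul, one_div, inv_mul_cancel₀ hp0, Real.rpow_neg_one]
  rw [Finset.sum_congr rfl hterm, Finset.sum_const, Nat.card_Ico, nsmul_eq_mul]
  field_simp

/-! ### Rapidly increasing flat averages improve the upper estimate -/

/-- If all coefficients are small, then the blocks cut by a family of few sets are negligible,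
and the upper estimate improves by the factor `γ`. -/
lemma IsBlockSeq.mul_sum_restrict_comb_le (hp : 1 < p) (hγ : γ ∈ Set.Ioo (0 : ℝ) 1)
    {x : ℕ → ℕ →₀ ℝ} (hx : IsBlockSeq x) {C : ℝ} (hC : 0 < C)
    (hup : ∀ b, tirNorm p γ (comb x b) ≤ C * pNorm p b) (m : ℕ) {n : ℕ} {E : Fin n → Finset ℕ}
    (hE : Consecutive E) {b : ℕ →₀ ℝ} {τ : ℝ} (hτ : 0 ≤ τ) (hb : ∀ i, |b i| ≤ τ) :
    γ * ∑ s, approxNorm p γ m (restrict (E s) (comb x b)) ≤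
      (n : ℝ) ^ (1 / p.conjExponent) * (γ * C * pNorm p b + n * τ * C) := by
  have hθ := conj_inv_pos hp
  obtain ⟨A, ν, B, -, hAn, hν, -, hB, hcut⟩ := hx.exists_cut hp hγ hE b
  refine (hcut m).trans ?_
  have hxC : ∀ i, tirNorm p γ (x i) ≤ C := fun i => by
    have h := hup (Finsupp.single i 1)
    rwa [pNorm_single hp, abs_one, mul_one, comb, Finsupp.linearCombination_single,
      one_smul] at h
  have hpart1 : ∑ s, approxNorm p γ m (comb x (restrict (B s) b)) ≤
      C * ((n : ℝ) ^ (1 / p.conjExponent) * pNorm p b) := by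
    refine (Finset.sum_le_sum fun s _ => (approxNorm_le_tirNorm hp hγ m _).trans
      (hup (restrict (B s) b))).trans ?_
    rw [← Finset.mul_sum]
    exact mul_le_mul_of_nonneg_left (sum_pNorm_restrict_le hp b hB) hC.le
  have hpart2 : ∑ i ∈ A, |b i| * ((ν i : ℝ) ^ (1 / p.conjExponent) * tirNorm p γ (x i)) ≤
      n * (τ * ((n : ℝ) ^ (1 / p.conjExponent) * C)) := by
    calc _ ≤ ∑ i ∈ A, τ * ((n : ℝ) ^ (1 / p.conjExponent) * C) := by
          refine Finset.sum_le_sum fun i _ => ?_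
          have h1 := hb i
          have h2 := hxC i
          have h3 := hν i
          have h4 := tirNorm_nonneg hp hγ (x i)
          gcongr
      _ = A.card * (τ * ((n : ℝ) ^ (1 / p.conjExponent) * C)) := by
        rw [Finset.sum_const, nsmul_eq_mul]
      _ ≤ _ := by gcongr
  calc _ ≤ γ * (C * ((n : ℝ) ^ (1 / p.conjExponent) * pNorm p b)) +
        n * (τ * ((n : ℝ) ^ (1 / p.conjExponent) * C)) :=
        add_le_add (mul_le_mul_of_nonneg_left hpart1 hγ.1.le) hpart2
    _ = _ := by ring

lemma oneNorm_comb_le (x : ℕ → ℕ →₀ ℝ) {c : ℕ →₀ ℝ} {τ : ℝ} {S : ℕ} (hc : ∀ i, |c i| ≤ τ)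
    (hS : ∀ i, S ≤ i → c i = 0) :
    oneNorm (comb x c) ≤ τ * ∑ i ∈ Finset.range S, oneNorm (x i) := by
  have hsub : c.support ⊆ Finset.range S := by
    intro i hi
    rw [Finset.mem_range]
    by_contra h
    exact Finsupp.mem_support_iff.1 hi (hS i (not_lt.1 h))
  rw [comb_eq_sum x c hsub, Finset.mul_sum]
  refine (Finset.le_sum_of_subadditive oneNorm (by simp [oneNorm]) oneNorm_add_le _ _).trans ?_
  exact Finset.sum_le_sum fun i _ => (oneNorm_smul_le _ _).trans
    (mul_le_mul_of_nonneg_right (hc i) (oneNorm_nonneg _))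

lemma mul_sum_restrict_le_oneNorm (hp : 1 < p) (hγ : γ ∈ Set.Ioo (0 : ℝ) 1) (m : ℕ) {n : ℕ}
    {E : Fin n → Finset ℕ} (hE : Consecutive E) (a : ℕ →₀ ℝ) :
    γ * ∑ s, approxNorm p γ m (restrict (E s) a) ≤ oneNorm a := by
  have h1 : ∑ s, approxNorm p γ m (restrict (E s) a) ≤ oneNorm a :=
    (Finset.sum_le_sum fun s _ => approxNorm_le_oneNorm hp hγ m _).trans
      (sum_oneNorm_restrict_le hE a)
  have h2 := oneNorm_nonneg a
  have h3 : 0 ≤ ∑ s, approxNorm p γ m (restrict (E s) a) :=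
    Finset.sum_nonneg fun s _ => approxNorm_nonneg m _
  nlinarith [hγ.1, hγ.2]

/-- Flat averages over intervals of rapidly increasing lengths: for each `n`, all averages but
one are either so short that they are small in comparison with `n ^ (1 / q)` even in `ℓ₁`, or so
long that `n` sets cut a negligible part of them. -/
lemma IsBlockSeq.exists_flat_upper_estimate (hp : 1 < p) (hγ : γ ∈ Set.Ioo (0 : ℝ) 1)
    {x : ℕ → ℕ →₀ ℝ} (hx : IsBlockSeq x) {C : ℝ} (hC : 0 < C)
    (hup : ∀ b, tirNorm p γ (comb x b) ≤ C * pNorm p b) :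
    ∃ s : ℕ → ℕ, StrictMono s ∧ ∀ (a : ℕ →₀ ℝ) (τ : ℝ), (∀ j, |a j| ≤ τ) →
      tirNorm p γ (comb x (comb (flat p s) a)) ≤ γ * C * pNorm p a + 3 * C * τ := by
  classical
  set θ := 1 / p.conjExponent with hθ
  have hθ0 : 0 < θ := conj_inv_pos hp
  have hp0 : 0 < p := by linarith
  set Λ : ℕ → ℝ := fun S => ∑ i ∈ Finset.range S, oneNorm (x i) with hΛ
  have hρ : ∀ S : ℕ, ∃ r : ℕ, S ≤ r ∧ Λ S ≤ C * (r : ℝ) ^ θ := by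
    intro S
    have ht : Filter.Tendsto (fun r : ℕ => (r : ℝ) ^ θ) Filter.atTop Filter.atTop :=
      (tendsto_rpow_atTop hθ0).comp tendsto_natCast_atTop_atTop
    obtain ⟨r, h1, h2⟩ := ((Filter.eventually_ge_atTop S).and
      (ht.eventually_ge_atTop (Λ S / C))).exists
    exact ⟨r, h1, by rwa [div_le_iff₀' hC] at h2⟩
  choose ρ hρS hρΛ using hρ
  -- The length of the `t`-th interval is at least `ρ (s t) ^ p`.
  let s : ℕ → ℕ := fun t => Nat.rec 0 (fun _ S => S + (⌈(ρ S : ℝ) ^ p⌉₊ + 1)) t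
  have hs_succ : ∀ t, s (t + 1) = s t + (⌈(ρ (s t) : ℝ) ^ p⌉₊ + 1) := fun t => rfl
  have hs : StrictMono s := strictMono_nat_of_lt_succ fun t => by rw [hs_succ]; omega
  have hlen : ∀ t, (ρ (s t) : ℝ) ^ p ≤ ((s (t + 1) - s t : ℕ) : ℝ) := by
    intro t
    rw [hs_succ, Nat.add_sub_cancel_left]
    refine (Nat.le_ceil _).trans ?_
    exact_mod_cast Nat.le_succ _
  have hlen1 : ∀ t, (1 : ℝ) ≤ ((s (t + 1) - s t : ℕ) : ℝ) := by
    intro t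
    exact_mod_cast Nat.sub_pos_of_lt (hs (Nat.lt_succ_self t))
  have hxC : ∀ i, tirNorm p γ (x i) ≤ C := fun i => by
    have h := hup (Finsupp.single i 1)
    rwa [pNorm_single hp, abs_one, mul_one, comb, Finsupp.linearCombination_single,
      one_smul] at h
  refine ⟨s, hs, fun a τ ha => ?_⟩
  have hτ : 0 ≤ τ := (abs_nonneg _).trans (ha 0)
  have hle1 : ∀ j, ((s (j + 1) - s j : ℕ) : ℝ) ^ (-(1 / p)) ≤ 1 := fun j =>
    Real.rpow_le_one_of_one_le_of_nonpos (hlen1 j) (by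
      rw [neg_nonpos]
      positivity)
  have hcoef : ∀ c : ℕ →₀ ℝ, (∀ j, |c j| ≤ τ) → ∀ i, |comb (flat p s) c i| ≤ τ := fun c hc =>
    abs_comb_flat_le hs hτ fun j => (mul_le_of_le_one_right (abs_nonneg _) (hle1 j)).trans (hc j)
  refine tirNorm_le hp hγ ?_ fun m n E hn hE => ?_
  · refine (hx.supNorm_comb_le hp hγ hxC (hcoef a ha)).trans ?_
    have h1 := mul_nonneg (mul_nonneg hγ.1.le hC.le) (pNorm_nonneg (p := p) a)
    have h2 := mul_nonneg hC.le hτ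
    nlinarith
  rw [← hθ]
  -- For the least such `t`, the averages with index above `t` are long in comparison with `n`,
  -- and those below `t` are short.
  have hex : ∃ t, ∀ j, t < j → n ≤ ρ (s j) :=
    ⟨n, fun j hj => hj.le.trans ((hs.le_apply (x := j)).trans (hρS _))⟩
  set t := Nat.find hex with ht
  have hlong : ∀ j, t < j → n ≤ ρ (s j) := Nat.find_spec hex
  have hshort : Λ (s t) ≤ C * (n : ℝ) ^ θ := by
    rcases Nat.eq_zero_or_pos t with h0 | h0
    · have : Λ (s t) = 0 := by
        rw [h0]
        exact Finset.sum_range_zero _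
      rw [this]
      positivity
    · have h1 : ¬ ∀ j, t - 1 < j → n ≤ ρ (s j) := Nat.find_min hex (by omega)
      push Not at h1
      obtain ⟨j, hj, hjn⟩ := h1
      have hjt : j = t := by
        by_contra hne
        exact absurd (hlong j (by omega)) (not_le.2 hjn)
      rw [hjt] at hjn
      refine (hρΛ _).trans ?_
      gcongr
  set lo := restrict (Finset.range t) a with hlo
  set hi := restrict (a.support.filter fun j => t < j) a with hhi
  have hdecomp : a = lo + Finsupp.single t (a t) + hi := by
    ext j
    simp only [hlo, hhi, Finsupp.add_apply, restrict_apply, Finset.mem_range,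
      Finset.mem_filter, Finsupp.mem_support_iff]
    rcases lt_trichotomy j t with h | h | h
    · rw [if_pos h, Finsupp.single_eq_of_ne (by omega), if_neg (by omega)]
      ring
    · subst h
      simp
    · rw [if_neg (by omega), Finsupp.single_eq_of_ne (by omega)]
      by_cases hj : a j = 0 <;> simp [h, hj]
  set X : (ℕ →₀ ℝ) → ℕ →₀ ℝ := fun c => comb x (comb (flat p s) c) with hX
  have hsplit : ∀ k, approxNorm p γ m (restrict (E k) (X a)) ≤
      approxNorm p γ m (restrict (E k) (X lo)) +
      approxNorm p γ m (restrict (E k) (X (Finsupp.single t (a t)))) +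
      approxNorm p γ m (restrict (E k) (X hi)) := by
    intro k
    have h : X a = X lo + X (Finsupp.single t (a t)) + X hi := by
      conv_lhs => rw [hdecomp]
      simp only [hX, comb, map_add]
    rw [h, restrict_add, restrict_add]
    exact (approxNorm_add hp hγ m _ _).trans
      (add_le_add (approxNorm_add hp hγ m _ _) le_rfl)
  have hpart1 : γ * ∑ k, approxNorm p γ m (restrict (E k) (X lo)) ≤ (n : ℝ) ^ θ * (C * τ) := by
    refine (mul_sum_restrict_le_oneNorm hp hγ m hE _).trans ?_
    have h1 : oneNorm (X lo) ≤ τ * Λ (s t) := by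
      refine oneNorm_comb_le x (hcoef lo fun j => (abs_restrict_le _ _ _).trans (ha j))
        fun i hi' => ?_
      by_contra hne
      obtain ⟨j, hj, hij⟩ := exists_mem_of_comb_flat_ne_zero hs hne
      have hjt : j < t := by
        rw [Finsupp.mem_support_iff, hlo, restrict_apply] at hj
        by_contra h
        exact hj (if_neg fun h' => h (Finset.mem_range.1 h'))
      have h3 : s (j + 1) ≤ s t := hs.monotone hjt
      rw [Finset.mem_Ico] at hij
      omega
    refine h1.trans ((mul_le_mul_of_nonneg_left hshort hτ).trans (le_of_eq (by ring)))
  have hpart2 : γ * ∑ k, approxNorm p γ m (restrict (E k) (X (Finsupp.single t (a t)))) ≤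
      (n : ℝ) ^ θ * (C * τ) := by
    have h1 := mul_sum_approxNorm_restrict_le hp hγ m hE Finset.univ
      (X (Finsupp.single t (a t)))
    rw [Finset.card_univ, Fintype.card_fin, ← hθ] at h1
    refine h1.trans ?_
    have h2 : tirNorm p γ (X (Finsupp.single t (a t))) ≤ C * |a t| := by
      have := hup (comb (flat p s) (Finsupp.single t (a t)))
      rwa [pNorm_comb_flat hp hs, pNorm_single hp] at this
    have h3 : C * |a t| ≤ C * τ := mul_le_mul_of_nonneg_left (ha t) hC.le
    exact mul_le_mul_of_nonneg_left (h2.trans h3) (by positivity)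
  have hpart3 : γ * ∑ k, approxNorm p γ m (restrict (E k) (X hi)) ≤
      (n : ℝ) ^ θ * (γ * C * pNorm p a + C * τ) := by
    have hn0 : (0 : ℝ) < n := by exact_mod_cast hn
    have hb : ∀ i, |comb (flat p s) hi i| ≤ τ / n := by
      refine abs_comb_flat_le hs (by positivity) fun j => ?_
      by_cases hj : t < j
      · have h1 : (n : ℝ) ^ p ≤ ((s (j + 1) - s j : ℕ) : ℝ) := by
          refine le_trans ?_ (hlen j)
          have := hlong j hj
          gcongr
        have h2 : ((s (j + 1) - s j : ℕ) : ℝ) ^ (-(1 / p)) ≤ (n : ℝ)⁻¹ := by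
          calc ((s (j + 1) - s j : ℕ) : ℝ) ^ (-(1 / p)) ≤ ((n : ℝ) ^ p) ^ (-(1 / p)) :=
                Real.rpow_le_rpow_of_nonpos (by positivity) h1 (by
                  rw [neg_nonpos]
                  positivity)
            _ = (n : ℝ)⁻¹ := by
              rw [← Real.rpow_mul hn0.le, mul_neg, mul_one_div_cancel hp0.ne',
                Real.rpow_neg_one]
        rw [div_eq_mul_inv]
        exact mul_le_mul ((abs_restrict_le _ _ _).trans (ha j)) h2 (by positivity) hτ
      · have h1 : hi j = 0 := by
          rw [hhi, restrict_apply, if_neg fun h => hj (Finset.mem_filter.1 h).2]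
        rw [h1, abs_zero, zero_mul]
        positivity
    refine (hx.mul_sum_restrict_comb_le hp hγ hC hup m hE (by positivity) hb).trans ?_
    rw [pNorm_comb_flat hp hs, ← hθ]
    refine mul_le_mul_of_nonneg_left ?_ (by positivity)
    have h1 : pNorm p hi ≤ pNorm p a := pNorm_restrict_le hp _ _
    have h2 : γ * C * pNorm p hi ≤ γ * C * pNorm p a :=
      mul_le_mul_of_nonneg_left h1 (mul_nonneg hγ.1.le hC.le)
    have h3 : (n : ℝ) * (τ / n) * C = C * τ := by
      field_simp
    rw [h3]
    linarith
  calc γ * ∑ k, approxNorm p γ m (restrict (E k) (X a))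
      ≤ γ * ∑ k, (approxNorm p γ m (restrict (E k) (X lo)) +
        approxNorm p γ m (restrict (E k) (X (Finsupp.single t (a t)))) +
        approxNorm p γ m (restrict (E k) (X hi))) :=
        mul_le_mul_of_nonneg_left (Finset.sum_le_sum fun k _ => hsplit k) hγ.1.le
    _ ≤ (n : ℝ) ^ θ * (C * τ) + (n : ℝ) ^ θ * (C * τ) +
        (n : ℝ) ^ θ * (γ * C * pNorm p a + C * τ) := by
      rw [Finset.sum_add_distrib, Finset.sum_add_distrib, mul_add, mul_add]
      exact add_le_add (add_le_add hpart1 hpart2) hpart3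
    _ = _ := by ring

/-- Averaging `K` at a time the vectors of `IsBlockSeq.exists_flat_upper_estimate` makes the
coefficients at most `K ^ (-1 / p)`, and the supremum term disappears. -/
lemma IsBlockSeq.exists_improved_upper_estimate (hp : 1 < p) (hγ : γ ∈ Set.Ioo (0 : ℝ) 1)
    {x : ℕ → ℕ →₀ ℝ} (hx : IsBlockSeq x) {c C : ℝ} (hC : 0 < C)
    (hlow : ∀ b, c * pNorm p b ≤ tirNorm p γ (comb x b))
    (hup : ∀ b, tirNorm p γ (comb x b) ≤ C * pNorm p b) :
    ∃ y : ℕ → ℕ →₀ ℝ, IsBlockSeq y ∧ (∀ b, c * pNorm p b ≤ tirNorm p γ (comb y b)) ∧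
      ∀ b, tirNorm p γ (comb y b) ≤ (1 + γ) / 2 * C * pNorm p b := by
  obtain ⟨s, hs, hest⟩ := hx.exists_flat_upper_estimate hp hγ hC hup
  have hp0 : 0 < p := by linarith
  have ht : Filter.Tendsto (fun K : ℕ => (K : ℝ) ^ (-(1 / p))) Filter.atTop (nhds 0) :=
    (tendsto_rpow_neg_atTop (by positivity)).comp tendsto_natCast_atTop_atTop
  have hpos : 0 < (1 - γ) / 6 := by linarith [hγ.2]
  obtain ⟨K, hK1, hK⟩ := ((Filter.eventually_ge_atTop 1).and
    (ht.eventually_le_const hpos)).exists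
  have hs' : StrictMono fun k : ℕ => K * k := fun i j hij => by
    have : 0 < K := hK1
    simpa using Nat.mul_lt_mul_of_pos_left hij this
  have hlen : ∀ k : ℕ, K * (k + 1) - K * k = K := fun k => by
    rw [mul_add, mul_one, Nat.add_sub_cancel_left]
  refine ⟨_, (hx.comp (isBlockSeq_flat (p := p) hs)).comp (isBlockSeq_flat (p := p) hs'),
    fun b => ?_, fun b => ?_⟩
  · rw [comb_comb, comb_comb]
    refine le_trans (le_of_eq ?_) (hlow _)
    rw [pNorm_comb_flat hp hs, pNorm_comb_flat hp hs']
  · rw [comb_comb, comb_comb]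
    have hP := pNorm_nonneg (p := p) b
    have hcoef : ∀ j, |comb (flat p fun k : ℕ => K * k) b j| ≤
        pNorm p b * (K : ℝ) ^ (-(1 / p)) := by
      refine abs_comb_flat_le hs' (by positivity) fun j => ?_
      rw [hlen]
      exact mul_le_mul_of_nonneg_right (abs_le_pNorm hp b j) (by positivity)
    refine (hest _ _ hcoef).trans ?_
    rw [pNorm_comb_flat hp hs']
    have h1 : pNorm p b * (K : ℝ) ^ (-(1 / p)) ≤ pNorm p b * ((1 - γ) / 6) :=
      mul_le_mul_of_nonneg_left hK hP
    have h2 := mul_le_mul_of_nonneg_left h1 (by linarith : 0 ≤ 3 * C)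
    linarith

/-- No bounded block sequence satisfies a lower `ℓ_p` estimate: iterating the improvement, the
constant of the upper estimate would fall below that of the lower one. -/
lemma IsBlockSeq.not_lower_estimate (hp : 1 < p) (hγ : γ ∈ Set.Ioo (0 : ℝ) 1)
    {x : ℕ → ℕ →₀ ℝ} (hx : IsBlockSeq x) {c D : ℝ} (hc : 0 < c)
    (hD : ∀ i, tirNorm p γ (x i) ≤ D)
    (hlow : ∀ b, c * pNorm p b ≤ tirNorm p γ (comb x b)) : False := by
  obtain ⟨C, hC, hup⟩ := hx.exists_upper_estimate hp hγ hD
  have hr0 : 0 < (1 + γ) / 2 := by linarith [hγ.1]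
  have hr1 : (1 + γ) / 2 < 1 := by linarith [hγ.2]
  have hiter : ∀ k : ℕ, ∃ y : ℕ → ℕ →₀ ℝ, IsBlockSeq y ∧
      (∀ b, c * pNorm p b ≤ tirNorm p γ (comb y b)) ∧
      ∀ b, tirNorm p γ (comb y b) ≤ ((1 + γ) / 2) ^ k * C * pNorm p b := by
    intro k
    induction k with
    | zero => exact ⟨x, hx, hlow, fun b => by simpa using hup b⟩
    | succ k ih =>
      obtain ⟨y, hy, hylow, hyup⟩ := ih
      obtain ⟨z, hz, hzlow, hzup⟩ :=
        hy.exists_improved_upper_estimate hp hγ (by positivity) hylow hyup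
      refine ⟨z, hz, hzlow, fun b => (hzup b).trans (le_of_eq ?_)⟩
      ring
  obtain ⟨k, hk⟩ := exists_pow_lt_of_lt_one (div_pos hc hC) hr1
  rw [lt_div_iff₀ hC] at hk
  obtain ⟨y, -, hylow, hyup⟩ := hiter k
  have h := (hylow (Finsupp.single 0 1)).trans (hyup (Finsupp.single 0 1))
  rw [pNorm_single hp, abs_one, mul_one, mul_one] at h
  exact absurd h (not_le.2 hk)

end Flat

/-! ### From upper `ℓ_q` estimates for functionals to lower `ℓ_p` estimates for blocks -/

section Duality

variable {p γ : ℝ}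

/-- Some choice of signs makes the off-diagonal part of a finite quadratic form nonnegative. -/
lemma exists_signs (M : ℕ → ℕ → ℝ) (F : Finset ℕ) :
    ∃ ε : ℕ → ℝ, (∀ i, |ε i| = 1) ∧
      ∑ i ∈ F, M i i ≤ ∑ i ∈ F, ∑ j ∈ F, ε i * ε j * M i j := by
  classical
  induction F using Finset.induction_on with
  | empty => exact ⟨fun _ => 1, by simp, by simp⟩
  | insert k F hk ih =>
    obtain ⟨ε, hε, hsum⟩ := ih
    obtain ⟨σ, hσ, hσ0⟩ : ∃ σ : ℝ, |σ| = 1 ∧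
        0 ≤ σ * (∑ j ∈ F, ε j * M k j + ∑ i ∈ F, ε i * M i k) := by
      rcases le_total 0 (∑ j ∈ F, ε j * M k j + ∑ i ∈ F, ε i * M i k) with h | h
      · exact ⟨1, by simp, by simpa using h⟩
      · exact ⟨-1, by simp, by linarith⟩
    have hσ2 : σ * σ = 1 := by rw [← abs_mul_abs_self, hσ, one_mul]
    refine ⟨Function.update ε k σ, fun i => ?_, ?_⟩
    · by_cases hi : i = k
      · subst hi
        simpa using hσ
      · simpa [hi] using hε i
    · have hupd : ∀ i ∈ F, Function.update ε k σ i = ε i := fun i hi =>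
        Function.update_of_ne (ne_of_mem_of_not_mem hi hk) _ _
      have h1 : ∑ i ∈ F, ∑ j ∈ F, Function.update ε k σ i * Function.update ε k σ j * M i j =
          ∑ i ∈ F, ∑ j ∈ F, ε i * ε j * M i j :=
        Finset.sum_congr rfl fun i hi => Finset.sum_congr rfl fun j hj => by
          rw [hupd i hi, hupd j hj]
      have h2 : ∑ j ∈ F, σ * Function.update ε k σ j * M k j = σ * ∑ j ∈ F, ε j * M k j := by
        rw [Finset.mul_sum]
        exact Finset.sum_congr rfl fun j hj => by rw [hupd j hj]; ring
      have h3 : ∑ i ∈ F, Function.update ε k σ i * σ * M i k = σ * ∑ i ∈ F, ε i * M i k := by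
        rw [Finset.mul_sum]
        exact Finset.sum_congr rfl fun i hi => by rw [hupd i hi]; ring
      simp only [Finset.sum_insert hk, Function.update_self, Finset.sum_add_distrib]
      rw [h1, h2, h3, hσ2]
      linarith

/-- An upper `ℓ_q` estimate forces a sequence of functionals to converge to zero pointwise. -/
lemma tendsto_of_upper_estimate (hp : 1 < p) {f : ℕ → (ℕ →₀ ℝ) →ₗ[ℝ] ℝ} {y : ℕ →₀ ℝ} {K : ℝ}
    (hf : ∀ (F : Finset ℕ) (a : ℕ → ℝ), ∑ i ∈ F, a i * f i y ≤
      K * (∑ i ∈ F, |a i| ^ p.conjExponent) ^ (1 / p.conjExponent)) :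
    Filter.Tendsto (fun i => f i y) Filter.atTop (nhds 0) := by
  have hq := (Real.HolderConjugate.conjExponent hp)
  have hp0 : 0 < p := by linarith
  rw [← Nat.cofinite_eq_atTop, Metric.tendsto_nhds]
  intro δ hδ
  rw [Filter.eventually_cofinite]
  by_contra hinf
  have ht : Filter.Tendsto (fun n : ℕ => (n : ℝ) ^ (1 / p)) Filter.atTop Filter.atTop :=
    (tendsto_rpow_atTop (by positivity)).comp tendsto_natCast_atTop_atTop
  obtain ⟨n, hn1, hn⟩ := ((Filter.eventually_ge_atTop 1).and
    (ht.eventually_gt_atTop (K / δ))).exists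
  obtain ⟨F, hF, hcard⟩ := Set.Infinite.exists_subset_card_eq hinf n
  -- Testing with `n` signs gives `n * δ ≤ K * n ^ (1 / q)`, that is, `n ^ (1 / p) ≤ K / δ`.
  have h := hf F fun i => SignType.sign (f i y)
  have h1 : ∀ i ∈ F, |((SignType.sign (f i y) : SignType) : ℝ)| ^ p.conjExponent = 1 := by
    intro i hi
    have h2 := hF hi
    simp only [Set.mem_ofPred_eq, dist_zero_right, not_lt, Real.norm_eq_abs] at h2
    have h3 : f i y ≠ 0 := by
      rintro h0
      rw [h0, abs_zero] at h2
      linarith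
    rcases lt_or_gt_of_ne h3 with h4 | h4 <;> simp [h4]
  rw [Finset.sum_congr rfl h1, Finset.sum_const, hcard, nsmul_eq_mul, mul_one] at h
  have h2 : (n : ℝ) * δ ≤ ∑ i ∈ F, ((SignType.sign (f i y) : SignType) : ℝ) * f i y := by
    rw [← hcard, ← nsmul_eq_mul]
    refine Finset.card_nsmul_le_sum _ _ _ fun i hi => ?_
    rw [sign_mul_self]
    simpa using hF hi
  have hn0 : (0 : ℝ) < n := by exact_mod_cast hn1
  have hsum : 1 / p + 1 / p.conjExponent = 1 := by
    simpa only [one_div] using hq.inv_add_inv_eq_one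
  have h3 : (n : ℝ) = (n : ℝ) ^ (1 / p) * (n : ℝ) ^ (1 / p.conjExponent) := by
    rw [← Real.rpow_add hn0, hsum, Real.rpow_one]
  have h4 : (0 : ℝ) < (n : ℝ) ^ (1 / p.conjExponent) := by positivity
  rw [div_lt_iff₀ hδ] at hn
  have h5 := h2.trans h
  rw [h3] at h5
  nlinarith

/-- Bounded vectors on which the functionals `f i` are large can be chosen as a block sequence,
for a subsequence of the functionals. -/
lemma exists_blockSeq_of_tendsto (hp : 1 < p) (hγ : γ ∈ Set.Ioo (0 : ℝ) 1)
    {f : ℕ → (ℕ →₀ ℝ) →ₗ[ℝ] ℝ} {c : ℝ} (hc : 0 < c)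
    (hnull : ∀ y, Filter.Tendsto (fun i => f i y) Filter.atTop (nhds 0))
    (hlow : ∀ i, ∃ y, tirNorm p γ y ≤ 1 ∧ c ≤ f i y) :
    ∃ (φ : ℕ → ℕ) (x : ℕ → ℕ →₀ ℝ), StrictMono φ ∧ IsBlockSeq x ∧
      (∀ j, tirNorm p γ (x j) ≤ 1) ∧ ∀ j, c / 2 ≤ f (φ j) (x j) := by
  classical
  -- Far along the sequence, a functional is negligible on the first `L` coordinates.
  have hstep : ∀ i L : ℕ, ∃ (i' L' : ℕ) (x : ℕ →₀ ℝ), i < i' ∧ L ≤ L' ∧ tirNorm p γ x ≤ 1 ∧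
      c / 2 ≤ f i' x ∧ ∀ k ∈ x.support, L ≤ k ∧ k < L' := by
    intro i L
    have hsmall : ∀ᶠ i' in Filter.atTop, ∀ k ∈ Finset.range L,
        |f i' (Finsupp.single k 1)| < c / (2 * (L + 1)) := by
      rw [Filter.eventually_all_finset]
      intro k _
      have h := (Metric.tendsto_nhds.1 (hnull (Finsupp.single k 1))) (c / (2 * (L + 1)))
        (by positivity)
      simpa [Real.dist_eq] using h
    obtain ⟨i', hi', hsm⟩ := ((Filter.eventually_gt_atTop i).and hsmall).exists
    obtain ⟨y, hy1, hyc⟩ := hlow i'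
    set x := restrict (y.support.filter fun k => L ≤ k) y with hx
    have hsupp : ∀ k ∈ x.support, k ∈ y.support ∧ L ≤ k := by
      intro k hk
      rw [Finsupp.mem_support_iff, hx, restrict_apply] at hk
      by_contra h
      exact hk (if_neg fun h' => h (Finset.mem_filter.1 h'))
    have hdecomp : y = ∑ k ∈ Finset.range L, y k • Finsupp.single k 1 + x := by
      ext l
      rw [Finsupp.add_apply, Finsupp.finsetSum_apply, hx, restrict_apply]
      simp only [Finsupp.smul_apply, smul_eq_mul, Finsupp.single_apply, mul_ite, mul_one,
        mul_zero, Finset.sum_ite_eq', Finset.mem_range, Finset.mem_filter,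
        Finsupp.mem_support_iff]
      by_cases hl : l < L
      · rw [if_pos hl, if_neg (by omega), add_zero]
      · by_cases hy0 : y l = 0
        · simp [hy0]
        · rw [if_neg hl, if_pos ⟨hy0, by omega⟩, zero_add]
    have hfy : f i' y = ∑ k ∈ Finset.range L, y k * f i' (Finsupp.single k 1) + f i' x := by
      conv_lhs => rw [hdecomp]
      simp only [map_add, map_sum, map_smul, smul_eq_mul]
    have hhead : ∑ k ∈ Finset.range L, y k * f i' (Finsupp.single k 1) ≤ c / 2 := by
      calc ∑ k ∈ Finset.range L, y k * f i' (Finsupp.single k 1)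
          ≤ ∑ k ∈ Finset.range L, c / (2 * (L + 1)) := by
            refine Finset.sum_le_sum fun k hk => ?_
            refine (le_abs_self _).trans ?_
            rw [abs_mul]
            have h1 := (abs_le_tirNorm hp hγ y k).trans hy1
            calc |y k| * |f i' (Finsupp.single k 1)| ≤ 1 * (c / (2 * (L + 1))) :=
                  mul_le_mul h1 (hsm k hk).le (abs_nonneg _) zero_le_one
              _ = _ := one_mul _
        _ = L * (c / (2 * (L + 1))) := by rw [Finset.sum_const, Finset.card_range, nsmul_eq_mul]
        _ ≤ c / 2 := by
          rw [mul_div_assoc', div_le_div_iff₀ (by positivity) (by positivity)]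
          nlinarith
    refine ⟨i', L + (y.support.sup id + 1), x, hi', by omega,
      (tirNorm_restrict_le hp hγ _ y).trans hy1, by linarith, fun k hk => ?_⟩
    obtain ⟨h1, h2⟩ := hsupp k hk
    have h3 : k ≤ y.support.sup id := Finset.le_sup (f := id) h1
    exact ⟨h2, by omega⟩
  choose nextI nextL nextX hI hL hN hfx hsupp using hstep
  let st : ℕ → ℕ × ℕ := fun t => Nat.rec (0, 0) (fun _ u => (nextI u.1 u.2, nextL u.1 u.2)) t
  have hst : ∀ t, st (t + 1) = (nextI (st t).1 (st t).2, nextL (st t).1 (st t).2) := fun _ => rfl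
  have hLmono : Monotone fun t => (st t).2 := monotone_nat_of_le_succ fun t => by
    rw [hst]
    exact hL _ _
  refine ⟨fun t => (st (t + 1)).1, fun t => nextX (st t).1 (st t).2, ?_, ?_, fun j => hN _ _,
    fun j => hfx _ _⟩
  · refine strictMono_nat_of_lt_succ fun t => ?_
    rw [hst (t + 1)]
    exact hI _ _
  · intro i j hij k hk l hl
    have h1 := (hsupp _ _ k hk).2
    have h2 := (hsupp _ _ l hl).1
    have h3 : (st (i + 1)).2 ≤ (st j).2 := hLmono hij
    rw [hst i] at h3
    exact h1.trans_le (h3.trans h2)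

/-- If functionals with an upper `ℓ_q` estimate are large on the respective members of a block
sequence, then the block sequence has a lower `ℓ_p` estimate. By unconditionality, signs can be
chosen such that the off-diagonal values of the functionals do no harm. -/
lemma IsBlockSeq.lower_estimate_of_functionals (hp : 1 < p) (hγ : γ ∈ Set.Ioo (0 : ℝ) 1)
    {x : ℕ → ℕ →₀ ℝ} (hx : IsBlockSeq x) {g : ℕ → (ℕ →₀ ℝ) →ₗ[ℝ] ℝ} {K d : ℝ} (hK : 0 < K)
    (hg : ∀ (F : Finset ℕ) (a : ℕ → ℝ) (y : ℕ →₀ ℝ), ∑ i ∈ F, a i * g i y ≤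
      K * (∑ i ∈ F, |a i| ^ p.conjExponent) ^ (1 / p.conjExponent) * tirNorm p γ y)
    (hgx : ∀ j, d ≤ g j (x j)) (b : ℕ →₀ ℝ) :
    d / K * pNorm p b ≤ tirNorm p γ (comb x b) := by
  have hq := (Real.HolderConjugate.conjExponent hp)
  have hp0 : 0 < p := by linarith
  set q := p.conjExponent with hqdef
  set S := ∑ i ∈ b.support, |b i| ^ p with hS
  have hS0 : 0 ≤ S := sum_rpow_nonneg _ _
  rcases hS0.eq_or_lt with h0 | hSpos
  · have : pNorm p b = 0 := by
      rw [pNorm, ← hS, ← h0, Real.zero_rpow (by positivity)]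
    rw [this, mul_zero]
    exact tirNorm_nonneg hp hγ _
  -- The coefficients that norm `b` in the duality of `ℓ_p` and `ℓ_q`.
  set a : ℕ → ℝ := fun i => SignType.sign (b i) * |b i| ^ (p - 1) with ha
  have hab : ∀ i, a i * b i = |b i| ^ p := by
    intro i
    rw [ha]
    rcases eq_or_ne (b i) 0 with h | h
    · simp [h, Real.zero_rpow hp0.ne']
    · have h1 : 0 < |b i| := abs_pos.2 h
      calc (SignType.sign (b i) : ℝ) * |b i| ^ (p - 1) * b i
          = |b i| ^ (p - 1) * (SignType.sign (b i) * b i) := by ring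
        _ = |b i| ^ (p - 1) * |b i| := by rw [sign_mul_self]
        _ = |b i| ^ p := by
          rw [← Real.rpow_add_one h1.ne', sub_add_cancel]
  have haq : ∀ i ∈ b.support, |a i| ^ q = |b i| ^ p := by
    intro i hi
    have h1 : b i ≠ 0 := Finsupp.mem_support_iff.1 hi
    have h2 : |((SignType.sign (b i) : SignType) : ℝ)| = 1 := by
      rcases lt_or_gt_of_ne h1 with h | h <;> simp [h]
    have h3 : (p - 1) * q = p := hq.sub_one_mul_conj
    rw [ha, abs_mul, h2, one_mul, abs_of_nonneg (Real.rpow_nonneg (abs_nonneg _) _),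
      ← Real.rpow_mul (abs_nonneg _), h3]
  obtain ⟨ε, hε, hsum⟩ := exists_signs (fun i j => a i * b j * g i (x j)) b.support
  set b' : ℕ →₀ ℝ := Finsupp.onFinset b.support (fun i => ε i * b i) fun i hi =>
    Finsupp.mem_support_iff.2 (right_ne_zero_of_mul hi) with hb'
  have hb'supp : b'.support ⊆ b.support := Finsupp.support_onFinset_subset
  have hb'apply : ∀ i, b' i = ε i * b i := fun i => rfl
  have hright : ∑ i ∈ b.support, ∑ j ∈ b.support, ε i * ε j * (a i * b j * g i (x j)) =
      ∑ i ∈ b.support, (ε i * a i) * g i (comb x b') := by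
    refine Finset.sum_congr rfl fun i _ => ?_
    rw [comb_eq_sum x b' hb'supp, map_sum, Finset.mul_sum]
    refine Finset.sum_congr rfl fun j _ => ?_
    rw [map_smul, smul_eq_mul, hb'apply]
    ring
  have hleft : d * S ≤ ∑ i ∈ b.support, a i * b i * g i (x i) := by
    rw [hS, Finset.mul_sum]
    refine Finset.sum_le_sum fun i _ => ?_
    rw [hab, mul_comm]
    exact mul_le_mul_of_nonneg_left (hgx i) (Real.rpow_nonneg (abs_nonneg _) _)
  have hnorm : ∑ i ∈ b.support, |ε i * a i| ^ q = S := by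
    refine Finset.sum_congr rfl fun i hi => ?_
    rw [abs_mul, hε, one_mul, haq i hi]
  have hmono : tirNorm p γ (comb x b') ≤ tirNorm p γ (comb x b) :=
    hx.tirNorm_comb_le_of_abs_le hp hγ fun i => by rw [hb'apply, abs_mul, hε, one_mul]
  have hmain := hg b.support (fun i => ε i * a i) (comb x b')
  rw [hnorm, ← hright] at hmain
  have hfin : d * S ≤ K * S ^ (1 / q) * tirNorm p γ (comb x b) :=
    (hleft.trans (hsum.trans hmain)).trans
      (mul_le_mul_of_nonneg_left hmono (by positivity))
  have hpq : 1 / p + 1 / q = 1 := by simpa only [one_div] using hq.inv_add_inv_eq_one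
  have hSsplit : S = S ^ (1 / p) * S ^ (1 / q) := by
    rw [← Real.rpow_add hSpos, hpq, Real.rpow_one]
  have hSq : 0 < S ^ (1 / q) := by positivity
  have hdiv : d * S ^ (1 / p) ≤ K * tirNorm p γ (comb x b) := by
    refine le_of_mul_le_mul_right ?_ hSq
    calc d * S ^ (1 / p) * S ^ (1 / q) = d * S := by rw [mul_assoc, ← hSsplit]
      _ ≤ K * S ^ (1 / q) * tirNorm p γ (comb x b) := hfin
      _ = _ := by ring
  rw [div_mul_eq_mul_div, div_le_iff₀' hK]
  exact hdiv

/-- The dual of the Tirilman norm admits no seminormalized sequence with an upper `ℓ_q` estimate: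
it would produce a bounded block sequence with a lower `ℓ_p` estimate. -/
lemma false_of_functionals (hp : 1 < p) (hγ : γ ∈ Set.Ioo (0 : ℝ) 1)
    {f : ℕ → (ℕ →₀ ℝ) →ₗ[ℝ] ℝ} {K c : ℝ} (hK : 0 < K) (hc : 0 < c)
    (hf : ∀ (F : Finset ℕ) (a : ℕ → ℝ) (y : ℕ →₀ ℝ), ∑ i ∈ F, a i * f i y ≤
      K * (∑ i ∈ F, |a i| ^ p.conjExponent) ^ (1 / p.conjExponent) * tirNorm p γ y)
    (hlow : ∀ i, ∃ y, tirNorm p γ y ≤ 1 ∧ c ≤ f i y) : False := by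
  classical
  have hnull : ∀ y, Filter.Tendsto (fun i => f i y) Filter.atTop (nhds 0) := fun y =>
    tendsto_of_upper_estimate (K := K * tirNorm p γ y) hp fun F a =>
      (hf F a y).trans (le_of_eq (by ring))
  obtain ⟨φ, x, hφ, hx, hx1, hfx⟩ := exists_blockSeq_of_tendsto hp hγ hc hnull hlow
  refine hx.not_lower_estimate hp hγ (c := c / 2 / K) (by positivity) hx1
    (hx.lower_estimate_of_functionals hp hγ (g := fun j => f (φ j)) hK (fun F a y => ?_) hfx)
  have h := hf (F.image φ) (Function.extend φ a 0) y
  rw [Finset.sum_image hφ.injective.injOn, Finset.sum_image hφ.injective.injOn] at h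
  simpa only [hφ.injective.extend_apply] using h

end Duality

/-! ### Functionals on the Tirilman space -/

section Dual

variable {p γ : ℝ} {hp : 1 < p} {hγ : γ ∈ Set.Ioo (0 : ℝ) 1}

/-- The inclusion of `c₀₀` into the Tirilman space. -/
def toTi (hp : 1 < p) (hγ : γ ∈ Set.Ioo (0 : ℝ) 1) (y : ℕ →₀ ℝ) : Ti p γ hp hγ :=
  UniformSpace.Completion.coe' (α := PreTi p γ hp hγ) y

lemma norm_toTi (y : ℕ →₀ ℝ) : ‖toTi hp hγ y‖ = tirNorm p γ y :=
  UniformSpace.Completion.norm_coe (E := PreTi p γ hp hγ) y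

/-- The restriction to `c₀₀` of a functional on the Tirilman space. -/
def dualRestrict (φ : StrongDual ℝ (Ti p γ hp hγ)) : (ℕ →₀ ℝ) →ₗ[ℝ] ℝ where
  toFun y := φ (toTi hp hγ y)
  map_add' y z :=
    (φ.comp (UniformSpace.Completion.toComplL (𝕜 := ℝ) (E := PreTi p γ hp hγ))).map_add y z
  map_smul' c y :=
    (φ.comp (UniformSpace.Completion.toComplL (𝕜 := ℝ) (E := PreTi p γ hp hγ))).map_smul c y

lemma dualRestrict_apply (φ : StrongDual ℝ (Ti p γ hp hγ)) (y : ℕ →₀ ℝ) :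
    dualRestrict φ y = φ (toTi hp hγ y) := rfl

lemma dualRestrict_le (φ : StrongDual ℝ (Ti p γ hp hγ)) (y : ℕ →₀ ℝ) :
    dualRestrict φ y ≤ ‖φ‖ * tirNorm p γ y := by
  have h := φ.le_opNorm (toTi hp hγ y)
  rw [norm_toTi] at h
  exact (le_abs_self _).trans h

lemma norm_le_of_dualRestrict_le (φ : StrongDual ℝ (Ti p γ hp hγ)) {c : ℝ} (hc : 0 ≤ c)
    (h : ∀ y, dualRestrict φ y ≤ c * tirNorm p γ y) : ‖φ‖ ≤ c := by
  have hbound : ∀ y : ℕ →₀ ℝ, ‖φ (toTi hp hγ y)‖ ≤ c * ‖toTi hp hγ y‖ := by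
    intro y
    have h1 := h (-y)
    have h2 : tirNorm p γ (-y) = tirNorm p γ y := by
      simpa using tirNorm_smul hp hγ (-1) y
    rw [map_neg, h2] at h1
    rw [norm_toTi]
    exact abs_le.2 ⟨neg_le.1 h1, h y⟩
  refine φ.opNorm_le_bound hc fun z => ?_
  induction z using UniformSpace.Completion.induction_on with
  | hp => exact isClosed_le (by fun_prop) (by fun_prop)
  | ih y => exact hbound y

lemma exists_le_dualRestrict (φ : StrongDual ℝ (Ti p γ hp hγ)) {c : ℝ} (hc : 0 ≤ c)
    (h : c < ‖φ‖) : ∃ y, tirNorm p γ y ≤ 1 ∧ c ≤ dualRestrict φ y := by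
  by_contra hcon
  push Not at hcon
  refine absurd (norm_le_of_dualRestrict_le φ hc fun y => ?_) (not_le.2 h)
  rcases (tirNorm_nonneg hp hγ y).eq_or_lt with h0 | hpos
  · have hy : y = 0 := Finsupp.ext fun i => abs_nonpos_iff.1
      ((abs_le_tirNorm hp hγ y i).trans h0.ge)
    rw [← h0, hy, map_zero, mul_zero]
  · have h1 := hcon ((tirNorm p γ y)⁻¹ • y) (by
      rw [tirNorm_smul hp hγ, abs_of_pos (inv_pos.2 hpos), inv_mul_cancel₀ hpos.ne'])
    rw [map_smul, smul_eq_mul, inv_mul_lt_iff₀ hpos, mul_comm] at h1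
    exact h1.le

end Dual

end Tirilman

end

theorem lemma2p8 (p q γ : ℝ) (hp : 1 < p) (hpq : 1 / p + 1 / q = 1)
    (hγ : γ ∈ Set.Ioo (0 : ℝ) 1) [Fact (1 ≤ ENNReal.ofReal q)] :
    ¬ ContainsIsomorphicCopy (StrongDual ℝ (Ti p γ hp hγ))
      (lp (fun _ : ℕ => ℝ) (ENNReal.ofReal q)) := by
  rintro ⟨Z, ⟨e⟩⟩
  have hc := Real.HolderConjugate.conjExponent hp
  have hq : q = p.conjExponent := by
    have h1 : 1 / p + 1 / p.conjExponent = 1 := by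
      simpa only [one_div] using hc.inv_add_inv_eq_one
    have h2 : 1 / q = 1 / p.conjExponent := by linarith
    simpa only [one_div, inv_inj] using h2
  have hq0 : 0 < q := hq ▸ hc.symm.pos
  have hqr : (ENNReal.ofReal q).toReal = q := ENNReal.toReal_ofReal hq0.le
  have hq1 : 0 < ENNReal.ofReal q := ENNReal.ofReal_pos.2 hq0
  let T : lp (fun _ : ℕ => ℝ) (ENNReal.ofReal q) →L[ℝ] StrongDual ℝ (Ti p γ hp hγ) :=
    Z.subtypeL.comp (e : lp (fun _ : ℕ => ℝ) (ENNReal.ofReal q) →L[ℝ] Z)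
  let S : Z →L[ℝ] lp (fun _ : ℕ => ℝ) (ENNReal.ofReal q) := e.symm
  have hTlow : ∀ v, ‖v‖ ≤ ‖S‖ * ‖T v‖ := by
    intro v
    have h := S.le_opNorm (e v)
    have h1 : S (e v) = v := e.symm_apply_apply v
    rw [h1] at h
    exact h
  let u : ℕ → ℝ → lp (fun _ : ℕ => ℝ) (ENNReal.ofReal q) := fun i r => lp.single _ i r
  have hM : 0 < ‖S‖ + 1 := by positivity
  refine Tirilman.false_of_functionals hp hγ (f := fun i => Tirilman.dualRestrict (T (u i 1)))
    (K := ‖T‖ + 1) (c := 1 / (‖S‖ + 1)) (by positivity) (by positivity) (fun F a y => ?_)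
    fun i => Tirilman.exists_le_dualRestrict _ (by positivity) ?_
  · have hsum : ∑ i ∈ F, a i * Tirilman.dualRestrict (T (u i 1)) y =
        Tirilman.dualRestrict (T (∑ i ∈ F, u i (a i))) y := by
      have h1 : ∀ i, u i (a i) = a i • u i 1 := fun i => by
        rw [← lp.single_smul, smul_eq_mul, mul_one]
      simp only [h1, map_sum, map_smul, Tirilman.dualRestrict_apply, sum_apply, smul_apply, smul_eq_mul]
    have hnorm : ‖∑ i ∈ F, u i (a i)‖ = (∑ i ∈ F, |a i| ^ q) ^ (1 / q) := by
      have h := lp.norm_sum_single (E := fun _ : ℕ => ℝ) (p := ENNReal.ofReal q)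
        (by rwa [hqr]) a F
      rw [hqr] at h
      simp only [Real.norm_eq_abs] at h
      rw [← h, one_div, Real.rpow_rpow_inv (norm_nonneg _) hq0.ne']
    rw [hsum, ← hq, ← hnorm]
    refine (Tirilman.dualRestrict_le _ y).trans ?_
    refine mul_le_mul_of_nonneg_right ?_ (Tirilman.tirNorm_nonneg hp hγ y)
    have h1 := T.le_opNorm (∑ i ∈ F, u i (a i))
    have h2 := norm_nonneg (∑ i ∈ F, u i (a i))
    linarith
  · have h1 := hTlow (u i 1)
    rw [lp.norm_single hq1, norm_one] at h1
    have h2 : 0 < ‖T (u i 1)‖ := by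
      by_contra h0
      have h3 : ‖T (u i 1)‖ = 0 := le_antisymm (not_lt.1 h0) (norm_nonneg _)
      rw [h3, mul_zero] at h1
      linarith
    rw [div_lt_iff₀ hM]
    nlinarith
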